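/- **Setting.** Let $A\in\mathbb R^{d\times d}$, $B\in\mathbb R^{d\times m}$, $K\in\mathbb R^{m\times d}$, where $A$ is invertible and $A$ commutes with $BK$. Let $x_0\in\mathbb R^d$ with $|x_0|\le R$, and let $x$ be the solution of $x_t=x_0+\int_0^t (A-BK)x_s\,ds$, $t\ge 0$. On a probability space let $(\xi_i)_{i\ge1}$ be i.i.d. positive random variables with $\mathbb E[e^{a\xi_1}]<\infty$ for all $a\in\mathbb R$, and let $W$ be a standard $d$-dimensional Brownian motion independent of $(\xi_i)_{i\ge 1}$. For $n\in\mathbb N$ put $\tau^n_k=\frac1n\sum_{i=1}^k\xi_i$, $N^n_t=\sup\{k\ge 0:\tau^n_k\le t\}$ and $\pi^n(t)=\tau^n_{N^n_t}$. For $\varepsilon\in(0,1)$ let $X^{\varepsilon,n}$ be the continuous solution of $$X^{\varepsilon,n}_t=x_0+\int_0^t\big(AX^{\varepsilon,n}_s-BK\,X^{\varepsilon,n}_{\pi^n(s)}\big)ds+\varepsilon W_t,\qquad t\ge 0 .$$ Assume that $n=n(\varepsilon)\in\mathbb N$ satisfies $n(\varepsilon)\to\infty$ and $\frac1{n(\varepsilon)\,\varepsilon}\to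 \mathsf c\in[0,\infty)$ as $\varepsilon\searrow0$ (Regimes 1 and 2). Put $\varkappa(\varepsilon)=\big|\frac1{n\varepsilon}-\mathsf c\big|$ and $M=\frac{\mathbb E[\xi_1^2]}{2\,\mathbb E[\xi_1]}$, and let $Z$ be the continuous solution of $$Z_t=\int_0^t(A-BK)Z_s\,ds-\mathsf c\,M\,BK\int_0^t(A-BK)x_s\,ds+W_t,\qquad t\ge 0 .$$ **Theorem 2.2 (Central Limit Type Theorem).** There is a number $\varepsilon_0\in(0,1)$ such that for every $T>0$ and all $0<\varepsilon<\varepsilon_0$, with $n=n(\varepsilon)$, $$\mathbb E\Big[\sup_{0\le t\le T}\big|X^{\varepsilon,n}_t-x_t-\varepsilon Z_t\big|\Big]\le\Big[\mathsf c\big(n^{-1/2}(n^{-1}+\varepsilon)+n^{-1/4}\big)+M\varkappa(\varepsilon)+n^{-1/2}\Big]\,C,$$ where the constant $C>0$ depends only on $A$, $B$, $K$, $T$, the law of $\xi_1$ and the bound $R$ on $|x_0|$. -/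

import Mathlib

open MeasureTheory ProbabilityTheory Filter Topology Set
open scoped NNReal ENNReal

namespace SampledControl

noncomputable section

/-- The vector `M v` in `ℝ^d` with its Euclidean norm, for a square matrix `M`. -/
def act {d : ℕ} (M : Matrix (Fin d) (Fin d) ℝ) (v : EuclideanSpace ℝ (Fin d)) :
    EuclideanSpace ℝ (Fin d) :=
  Matrix.toEuclideanCLM (n := Fin d) (𝕜 := ℝ) M v

/-- A standard `d`-dimensional Brownian motion: the coordinates are independent standard
real Brownian motions (started at `0`, with almost surely continuous paths). -/
structure IsBrownianMotion {Ω : Type*} [MeasurableSpace Ω] {d : ℕ}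
    (W : ℝ≥0 → Ω → EuclideanSpace ℝ (Fin d)) (P : Measure Ω) : Prop where
  measurable : ∀ t, Measurable (W t)
  coord : ∀ i : Fin d, IsBrownianReal (fun t ω => W t ω i) P
  indep : iIndepFun (fun (i : Fin d) (ω : Ω) (t : ℝ≥0) => W t ω i) P

/-- The law `ν` of an inter-sampling time: a law on `(0, ∞)` whose moment generating function
is finite everywhere. -/
structure IsSamplingLaw (ν : Measure ℝ) : Prop where
  prob : IsProbabilityMeasure ν
  pos : ∀ᵐ x ∂ν, 0 < x
  mgf_finite : ∀ a : ℝ, Integrable (fun x => Real.exp (a * x)) ν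

/-- `ξ 0, ξ 1, …` (the variables `ξ_1, ξ_2, …`) are i.i.d. random variables with law `ν`. -/
structure IsIID {Ω : Type*} [MeasurableSpace Ω] (ξ : ℕ → Ω → ℝ) (ν : Measure ℝ)
    (P : Measure Ω) : Prop where
  measurable : ∀ i, Measurable (ξ i)
  law : ∀ i, HasLaw (ξ i) ν P
  indep : iIndepFun ξ P

/-- `M = E[ξ₁²] / (2 E[ξ₁])`. -/
def meanAge (ν : Measure ℝ) : ℝ := (∫ x, x ^ 2 ∂ν) / (2 * ∫ x, x ∂ν)

/-- The sampling times `τ^n_k = ∑_{i=1}^k ξ_i / n`. -/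
def samplingTime {Ω : Type*} (ξ : ℕ → Ω → ℝ) (n k : ℕ) (ω : Ω) : ℝ :=
  ∑ i ∈ Finset.range k, ξ i ω / n

/-- The renewal process `N^n_t = sup {k : τ^n_k ≤ t}`; the set is almost surely bounded
when the `ξ_i` are i.i.d. and positive and `n ≥ 1`. -/
def renewalCount {Ω : Type*} (ξ : ℕ → Ω → ℝ) (n : ℕ) (t : ℝ) (ω : Ω) : ℕ :=
  sSup {k : ℕ | samplingTime ξ n k ω ≤ t}

/-- The last sampling time before `t`, `π^n(t) = τ^n_{N^n_t}`. -/
def lastSample {Ω : Type*} (ξ : ℕ → Ω → ℝ) (n : ℕ) (t : ℝ) (ω : Ω) : ℝ :=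
  samplingTime ξ n (renewalCount ξ n t ω) ω

/-- `x` is a continuous solution on `[0, ∞)` of `x_t = x₀ + ∫_0^t (A - BK) x_s ds`. -/
structure IsIdealSolution {d m : ℕ} (A : Matrix (Fin d) (Fin d) ℝ)
    (B : Matrix (Fin d) (Fin m) ℝ) (K : Matrix (Fin m) (Fin d) ℝ)
    (x₀ : EuclideanSpace ℝ (Fin d)) (x : ℝ → EuclideanSpace ℝ (Fin d)) : Prop where
  continuousOn : ContinuousOn x (Ici 0)
  eq : ∀ t, 0 ≤ t → x t = x₀ + ∫ s in (0 : ℝ)..t, act (A - B * K) (x s)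

/-- A stochastic process in time `[0, ∞)` with almost surely continuous paths. -/
structure IsContinuousProcess {Ω : Type*} [MeasurableSpace Ω] {d : ℕ}
    (X : ℝ → Ω → EuclideanSpace ℝ (Fin d)) (P : Measure Ω) : Prop where
  aemeasurable : ∀ t, 0 ≤ t → AEMeasurable (X t) P
  continuousOn : ∀ᵐ ω ∂P, ContinuousOn (fun t => X t ω) (Ici 0)

/-- `X = X^{ε,n}` solves the sample-and-hold equation with additive noise
`X_t = x₀ + ∫_0^t (A X_s - BK X_{π^n(s)}) ds + ε W_t`, `t ≥ 0`. -/
structure IsSampledSolution {Ω : Type*} [MeasurableSpace Ω] {d m : ℕ}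
    (A : Matrix (Fin d) (Fin d) ℝ) (B : Matrix (Fin d) (Fin m) ℝ)
    (K : Matrix (Fin m) (Fin d) ℝ) (x₀ : EuclideanSpace ℝ (Fin d))
    (ξ : ℕ → Ω → ℝ) (W : ℝ≥0 → Ω → EuclideanSpace ℝ (Fin d)) (P : Measure Ω)
    (ε : ℝ) (n : ℕ) (X : ℝ → Ω → EuclideanSpace ℝ (Fin d)) : Prop
    extends IsContinuousProcess X P where
  eq : ∀ᵐ ω ∂P, ∀ t : ℝ≥0, X t ω = x₀
    + (∫ s in (0 : ℝ)..t, (act A (X s ω) - act (B * K) (X (lastSample ξ n s ω) ω)))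
    + ε • W t ω

/-- `Z` solves
`Z_t = ∫_0^t (A - BK) Z_s ds - c M BK ∫_0^t (A - BK) x_s ds + W_t`, `t ≥ 0`. -/
structure IsFluctuationLimit {Ω : Type*} [MeasurableSpace Ω] {d m : ℕ}
    (A : Matrix (Fin d) (Fin d) ℝ) (B : Matrix (Fin d) (Fin m) ℝ)
    (K : Matrix (Fin m) (Fin d) ℝ) (x : ℝ → EuclideanSpace ℝ (Fin d))
    (W : ℝ≥0 → Ω → EuclideanSpace ℝ (Fin d)) (P : Measure Ω)
    (c M : ℝ) (Z : ℝ → Ω → EuclideanSpace ℝ (Fin d)) : Prop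
    extends IsContinuousProcess Z P where
  eq : ∀ᵐ ω ∂P, ∀ t : ℝ≥0, Z t ω =
    (∫ s in (0 : ℝ)..t, act (A - B * K) (Z s ω))
    - (c * M) • act (B * K) (∫ s in (0 : ℝ)..t, act (A - B * K) (x s))
    + W t ω

/-- The joint scaling `n = n(ε)` of Regimes 1 and 2: as `ε ↘ 0`, `n(ε) → ∞` and
`1 / (n(ε) ε) → c ∈ [0, ∞)`. -/
structure IsScaling (c : ℝ) (n : ℝ → ℕ) : Prop where
  nonneg : 0 ≤ c
  tendsto_atTop : Tendsto n (𝓝[>] 0) atTop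
  tendsto_ratio : Tendsto (fun ε : ℝ => 1 / ((n ε : ℝ) * ε)) (𝓝[>] 0) (𝓝 c)

/-- `ϰ = |1 / (n ε) - c|`. -/
def kappa (c ε : ℝ) (n : ℕ) : ℝ := |1 / ((n : ℝ) * ε) - c|

/-- `sup_{0 ≤ t ≤ T} |X_t - x_t - ε Z_t|`, with values in `[0, ∞]`. -/
def supError {Ω : Type*} {d : ℕ} (X : ℝ → Ω → EuclideanSpace ℝ (Fin d))
    (x : ℝ → EuclideanSpace ℝ (Fin d)) (Z : ℝ → Ω → EuclideanSpace ℝ (Fin d))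
    (ε T : ℝ) (ω : Ω) : ℝ≥0∞ :=
  ⨆ t ∈ Icc (0 : ℝ) T, ‖X t ω - x t - ε • Z t ω‖ₑ

end

end SampledControl

/-!
Write `L = A - BK`, `G = BK` and `π` for the last sampling time. The equation for `X` reads
`dX = (L X + G (X - X ∘ π)) dt + ε dW`, so the noise cancels in `D = X - x - ε Z`, which solves
`D' = L D + G (X - X ∘ π) + ε c M G L x`. By Grönwall's inequality it suffices to bound the two
forcing terms on `[0, T]`.

* The term `ε c M G L x` is deterministic, and `ε c ≤ 1 / n + ε ϰ` by the definition of `ϰ`. Hence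
  it is `O(M / n + M ϰ)`, of the order of the right-hand side. Only its size matters, and no
  averaging of `X - X ∘ π` against it is needed.
* For `G (X - X ∘ π)`, the path `U = X - ε W` has an integrable derivative, so its increment over
  `[π s, s]` is governed by the age `s - π s`, and what is left is `ε (W s - W (π s))`. Young's
  inequality with weight `√n` turns both into square integrals
  (`exists_pathwise_error_bound`): the forcing is at most a constant times
  `√n (∫ (s - π s) + ∫ ‖W s - W (π s)‖²) + n ^ (-1/2) (1 + ∫ ‖W s‖² + ∫ ‖W s - W (π s)‖²)`.

Two expectations remain, both of order `1 / n`. Since the `k`-th interval length is independent of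
`{τ_k ≤ T}`, one has `E ∫ (s - π s) ≤ ∑ P(τ_k ≤ T) E[ξ²] / n²`, and the same independence applied
to `min ξ 1` gives `∑ P(τ_k ≤ T) E[min ξ 1] ≤ n T + 1` (`IsIID.tsum_measure_mul_le`); with
Borel–Cantelli this also shows that the sampling times do not accumulate. Finally `π s` is
independent of `W`, so `E ‖W s - W (π s)‖² ≤ d E(s - π s)` (`lintegral_increment_random_le`).
-/

namespace SampledControl

/-! ### Delay equations with a linear drift -/

section

/-- Grönwall's inequality in a form that tolerates a delay: `u` need only satisfy the integral
inequality along every exponential majorant `m * exp (β s)` of `u`. Taking for `m` the maximum of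
`u s * exp (-β s)` closes the estimate. -/
lemma le_mul_exp_of_forall_majorant {u : ℝ → ℝ} {T β D : ℝ} (hT : 0 ≤ T)
    (hu : ContinuousOn u (Icc 0 T)) (hu0 : ∀ t ∈ Icc 0 T, 0 ≤ u t)
    (h : ∀ m, 0 ≤ m → (∀ s ∈ Icc 0 T, u s ≤ m * Real.exp (β * s)) →
      ∀ t ∈ Icc 0 T, u t ≤ D + m * (Real.exp (β * t) - 1)) :
    ∀ t ∈ Icc 0 T, u t ≤ D * Real.exp (β * t) := by
  have hcont : ContinuousOn (fun s => u s * Real.exp (-(β * s))) (Icc 0 T) :=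
    hu.mul (by fun_prop)
  obtain ⟨r, hr, hmax⟩ := isCompact_Icc.exists_isMaxOn ⟨0, left_mem_Icc.2 hT⟩ hcont
  set m := u r * Real.exp (-(β * r)) with hm
  have hinv : ∀ s, u s = u s * Real.exp (-(β * s)) * Real.exp (β * s) := fun s => by
    rw [mul_assoc, ← Real.exp_add]; simp
  have hmaj : ∀ s ∈ Icc 0 T, u s ≤ m * Real.exp (β * s) := fun s hs => by
    rw [hinv s]
    exact mul_le_mul_of_nonneg_right (hmax hs) (Real.exp_pos _).le
  have hmD : m ≤ D := by
    have h1 := h m (mul_nonneg (hu0 r hr) (Real.exp_pos _).le) hmaj r hr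
    rw [hinv r, ← hm] at h1
    linarith
  exact fun t ht => (hmaj t ht).trans (mul_le_mul_of_nonneg_right hmD (Real.exp_pos _).le)

lemma integral_mul_exp (β m t : ℝ) :
    ∫ s in (0 : ℝ)..t, β * (m * Real.exp (β * s)) = m * (Real.exp (β * t) - 1) := by
  have h : ∀ s ∈ uIcc 0 t, HasDerivAt (fun s => m * Real.exp (β * s))
      (β * (m * Real.exp (β * s))) s := fun s _ => by
    have h1 : HasDerivAt (fun s => β * s) β s := by simpa using (hasDerivAt_id s).const_mul β
    exact (h1.exp.const_mul m).congr_deriv (by ring)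
  rw [intervalIntegral.integral_eq_sub_of_hasDerivAt h
    ((by fun_prop : Continuous _).intervalIntegrable _ _)]
  simp
  ring

variable {E F : Type*} [NormedAddCommGroup E] [NormedSpace ℝ E] [NormedAddCommGroup F]

lemma intervalIntegrable_comp_delay {f : ℝ × ℝ → F} (hf : Continuous f) {p : ℝ → ℝ}
    (hp : Measurable p) {T : ℝ} (hT : 0 ≤ T) (hpT : ∀ s ∈ Icc 0 T, p s ∈ Icc 0 s) :
    IntervalIntegrable (fun s => f (s, p s)) volume 0 T := by
  obtain ⟨b, hb⟩ := (isCompact_Icc.prod isCompact_Icc).exists_bound_of_continuousOn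
    (hf.continuousOn (s := Icc 0 T ×ˢ Icc 0 T))
  rw [intervalIntegrable_iff_integrableOn_Icc_of_le hT]
  refine Measure.integrableOn_of_bounded (M := b) (by simp)
    (hf.comp_stronglyMeasurable
      (measurable_id.prodMk hp).stronglyMeasurable).aestronglyMeasurable ?_
  exact (ae_restrict_iff' measurableSet_Icc).2
    (.of_forall fun s hs => hb _ ⟨hs, (hpT s hs).1, (hpT s hs).2.trans hs.2⟩)

/-- A priori bound for the linear delay equation `U' = A U - G U(p) + f`, `p s ≤ s`. -/
lemma norm_le_of_delay_equation {A G : E →L[ℝ] E} {β T : ℝ}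
    (hβ : ‖A‖ + ‖G‖ ≤ β) (hT : 0 ≤ T) {p : ℝ → ℝ}
    (hpT : ∀ s ∈ Icc 0 T, p s ∈ Icc 0 s) {U f : ℝ → E} {u₀ : E} (hU : Continuous U)
    (hf : IntervalIntegrable f volume 0 T)
    (heq : ∀ t ∈ Icc 0 T, U t = u₀ + ∫ s in (0 : ℝ)..t, (A (U s) - G (U (p s)) + f s)) :
    ∀ t ∈ Icc 0 T, ‖U t‖ ≤ (‖u₀‖ + ∫ s in (0 : ℝ)..T, ‖f s‖) * Real.exp (β * t) := by
  have hβ0 : 0 ≤ β := (add_nonneg (norm_nonneg _) (norm_nonneg _)).trans hβ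
  refine le_mul_exp_of_forall_majorant hT hU.norm.continuousOn (fun _ _ => norm_nonneg _) ?_
  intro m hm hmaj t ht
  have hft : IntervalIntegrable f volume 0 t :=
    hf.mono_set (by rw [uIcc_of_le ht.1, uIcc_of_le hT]; exact Icc_subset_Icc_right ht.2)
  have hbound : ∀ s ∈ Icc 0 t, ‖A (U s) - G (U (p s)) + f s‖
      ≤ β * (m * Real.exp (β * s)) + ‖f s‖ := fun s hs => by
    have hsT : s ∈ Icc 0 T := ⟨hs.1, hs.2.trans ht.2⟩
    have h1 : ‖A (U s)‖ ≤ ‖A‖ * (m * Real.exp (β * s)) :=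
      (A.le_opNorm _).trans (mul_le_mul_of_nonneg_left (hmaj s hsT) (norm_nonneg _))
    have hps := hpT s hsT
    have h2 : ‖G (U (p s))‖ ≤ ‖G‖ * (m * Real.exp (β * s)) := by
      refine (G.le_opNorm _).trans (mul_le_mul_of_nonneg_left ?_ (norm_nonneg _))
      refine (hmaj _ ⟨hps.1, hps.2.trans hsT.2⟩).trans ?_
      have := hps.2
      gcongr
    have h3 : (‖A‖ + ‖G‖) * (m * Real.exp (β * s)) ≤ β * (m * Real.exp (β * s)) :=
      mul_le_mul_of_nonneg_right hβ (by positivity)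
    calc _ ≤ ‖A (U s)‖ + ‖G (U (p s))‖ + ‖f s‖ :=
          (norm_add_le _ _).trans (add_le_add_left (norm_sub_le _ _) _)
      _ ≤ _ := by linarith
  rw [heq t ht]
  refine (norm_add_le _ _).trans ?_
  rw [add_assoc]
  refine add_le_add_right ?_ _
  have hexp : IntervalIntegrable (fun s => β * (m * Real.exp (β * s))) volume 0 t :=
    (by fun_prop : Continuous _).intervalIntegrable _ _
  calc ‖∫ s in (0 : ℝ)..t, (A (U s) - G (U (p s)) + f s)‖
      ≤ ∫ s in (0 : ℝ)..t, (β * (m * Real.exp (β * s)) + ‖f s‖) :=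
        intervalIntegral.norm_integral_le_of_norm_le ht.1
          (.of_forall fun s hs => hbound s (Ioc_subset_Icc_self hs)) (hexp.add hft.norm)
    _ = m * (Real.exp (β * t) - 1) + ∫ s in (0 : ℝ)..t, ‖f s‖ := by
        rw [intervalIntegral.integral_add hexp hft.norm, integral_mul_exp]
    _ ≤ _ := by
        rw [add_comm]
        refine add_le_add_left ?_ _
        exact intervalIntegral.integral_mono_interval le_rfl ht.1 ht.2
          (.of_forall fun _ => norm_nonneg _) hf.norm

lemma sq_integral_le {f : ℝ → ℝ} {T : ℝ} (hT : 0 < T) (hf : IntervalIntegrable f volume 0 T)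
    (hf2 : IntervalIntegrable (fun s => f s ^ 2) volume 0 T) :
    (∫ s in (0 : ℝ)..T, f s) ^ 2 ≤ T * ∫ s in (0 : ℝ)..T, f s ^ 2 := by
  set I := ∫ s in (0 : ℝ)..T, f s
  have h0 : 0 ≤ ∫ s in (0 : ℝ)..T, (T * f s - I) ^ 2 :=
    intervalIntegral.integral_nonneg hT.le fun _ _ => sq_nonneg _
  have h1 : ∫ s in (0 : ℝ)..T, (T * f s - I) ^ 2
      = T ^ 2 * (∫ s in (0 : ℝ)..T, f s ^ 2) - 2 * T * I * I + T * I ^ 2 := by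
    have : (fun s => (T * f s - I) ^ 2)
        = fun s => T ^ 2 * f s ^ 2 - 2 * T * I * f s + I ^ 2 := by ext s; ring
    rw [this, intervalIntegral.integral_add ((hf2.const_mul _).sub (hf.const_mul _))
      intervalIntegrable_const, intervalIntegral.integral_sub (hf2.const_mul _) (hf.const_mul _)]
    simp [I]
  have h2 : 0 ≤ T * (T * (∫ s in (0 : ℝ)..T, f s ^ 2) - I ^ 2) := by
    rw [h1] at h0; linarith
  have := nonneg_of_mul_nonneg_right h2 hT
  linarith

/-- On an interval whose length is not controlled pathwise, `∫ J` is split by Young's inequality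
with weight `q`, so that only the length and the full square integral enter. -/
lemma integral_le_of_subinterval {J : ℝ → ℝ} {a b T q : ℝ} (hq : 0 < q) (ha : 0 ≤ a) (hab : a ≤ b)
    (hb : b ≤ T) (hJ : IntervalIntegrable J volume 0 T)
    (hJ2 : IntervalIntegrable (fun s => J s ^ 2) volume 0 T) :
    ∫ s in a..b, J s ≤ (q * (b - a) + q⁻¹ * ∫ s in (0 : ℝ)..T, J s ^ 2) / 2 := by
  have hsub : uIcc a b ⊆ uIcc 0 T := by
    rw [uIcc_of_le hab, uIcc_of_le (ha.trans (hab.trans hb))]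
    exact Icc_subset_Icc ha hb
  have hJ' := hJ.mono_set hsub
  have hJ2' := hJ2.mono_set hsub
  have h1 : ∫ s in a..b, J s ≤ ∫ s in a..b, (q / 2 + q⁻¹ / 2 * J s ^ 2) := by
    refine intervalIntegral.integral_mono_on hab hJ'
      (intervalIntegrable_const.add (hJ2'.const_mul _)) fun s _ => ?_
    have : q / 2 + q⁻¹ / 2 * J s ^ 2 - J s = q⁻¹ / 2 * (J s - q) ^ 2 := by field_simp; ring
    have : 0 ≤ q⁻¹ / 2 * (J s - q) ^ 2 := by positivity
    linarith
  rw [intervalIntegral.integral_add intervalIntegrable_const (hJ2'.const_mul _),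
    intervalIntegral.integral_const, intervalIntegral.integral_const_mul, smul_eq_mul] at h1
  have h2 : ∫ s in a..b, J s ^ 2 ≤ ∫ s in (0 : ℝ)..T, J s ^ 2 :=
    intervalIntegral.integral_mono_interval ha hab hb (.of_forall fun _ => sq_nonneg _) hJ2
  have h3 := mul_le_mul_of_nonneg_left h2 (by positivity : 0 ≤ q⁻¹ / 2)
  linarith

end

/-! ### Pathwise error estimate -/

section

variable {E : Type*} [NormedAddCommGroup E] [NormedSpace ℝ E] [CompleteSpace E]

/-- Pathwise form of the theorem. The error is controlled by the integrated age `∫ (s - p s)`, the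
integrated squared noise increments since the last sample, and the energy `∫ ‖W‖²`; the weight `q`
is free and is later taken to be `√n`. -/
lemma exists_pathwise_error_bound {β R T : ℝ} (hβ : 0 ≤ β) (hR : 0 ≤ R) (hT : 0 < T) :
    ∃ C, 0 < C ∧ ∀ (A G : E →L[ℝ] E) (x₀ : E) (X x Z W : ℝ → E) (p : ℝ → ℝ) (ε c q : ℝ),
      ‖A‖ + ‖G‖ ≤ β → ‖x₀‖ ≤ R → Continuous X → Continuous x → Continuous Z → Continuous W →
      Measurable p → (∀ s ∈ Icc 0 T, p s ∈ Icc 0 s) → 0 ≤ ε → ε ≤ 1 → 0 ≤ c → 0 < q →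
      (∀ t ∈ Icc 0 T, X t = x₀ + (∫ s in (0 : ℝ)..t, (A (X s) - G (X (p s)))) + ε • W t) →
      (∀ t ∈ Icc 0 T, x t = x₀ + ∫ s in (0 : ℝ)..t, (A (x s) - G (x s))) →
      (∀ t ∈ Icc 0 T, Z t = (∫ s in (0 : ℝ)..t, (A (Z s) - G (Z s)))
        - c • G (∫ s in (0 : ℝ)..t, (A (x s) - G (x s))) + W t) →
      ∀ t ∈ Icc 0 T, ‖X t - x t - ε • Z t‖ ≤ C *
        (q * ((∫ s in (0 : ℝ)..T, (s - p s)) + ∫ s in (0 : ℝ)..T, ‖W s - W (p s)‖ ^ 2)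
          + q⁻¹ * (1 + (∫ s in (0 : ℝ)..T, ‖W s‖ ^ 2)
            + ∫ s in (0 : ℝ)..T, ‖W s - W (p s)‖ ^ 2)
          + ε * c) := by
  -- The constant collects the factors of `q * (α + Q)`, `q⁻¹ * (1 + P + Q)` and `ε * c` below;
  -- `V` bounds every Grönwall factor on `[0, T]`.
  set V := Real.exp (β * T) with hV
  have hV0 : 0 < V := Real.exp_pos _
  refine ⟨V * (β + T * β ^ 3 * (T * (V ^ 2 * (2 * R ^ 2 + 4 * β ^ 2 * T)) + 2) + β * T
    + β ^ 2 * T * R * V) + 1, by positivity, ?_⟩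
  intro A G x₀ X x Z W p ε c q hAG hx₀ hX hx hZ hW hp hpT hε0 hε1 hc hq hXe hxe hZe
  have hG : ‖G‖ ≤ β := le_trans (le_add_of_nonneg_left (norm_nonneg _)) hAG
  have h0T : ∀ t ∈ Icc 0 T, uIcc 0 t ⊆ uIcc 0 T := fun t ht => by
    rw [uIcc_of_le ht.1, uIcc_of_le hT.le]; exact Icc_subset_Icc_right ht.2
  have expT : ∀ t ∈ Icc 0 T, Real.exp (β * t) ≤ V := fun t ht =>
    Real.exp_le_exp.2 (mul_le_mul_of_nonneg_left ht.2 hβ)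
  have hIR : ∀ {f : ℝ × ℝ → ℝ}, Continuous f →
      IntervalIntegrable (fun s => f (s, p s)) volume 0 T := fun hf =>
    intervalIntegrable_comp_delay hf hp hT.le hpT
  have hIE : ∀ {f : ℝ × ℝ → E}, Continuous f →
      IntervalIntegrable (fun s => f (s, p s)) volume 0 T := fun hf =>
    intervalIntegrable_comp_delay hf hp hT.le hpT
  set P := ∫ s in (0 : ℝ)..T, ‖W s‖ ^ 2
  set Q := ∫ s in (0 : ℝ)..T, ‖W s - W (p s)‖ ^ 2
  set α := ∫ s in (0 : ℝ)..T, (s - p s)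
  have hP0 : 0 ≤ P := intervalIntegral.integral_nonneg hT.le fun _ _ => sq_nonneg _
  have hQ0 : 0 ≤ Q := intervalIntegral.integral_nonneg hT.le fun _ _ => sq_nonneg _
  have hα0 : 0 ≤ α := intervalIntegral.integral_nonneg hT.le fun s hs =>
    sub_nonneg.2 (hpT s hs).2
  let Y : ℝ → ℝ := fun s => ‖W s‖ + ‖W s - W (p s)‖
  have hY0 : ∀ s, 0 ≤ Y s := fun s => by positivity
  have hYi : IntervalIntegrable Y volume 0 T :=
    hIR (f := fun z => ‖W z.1‖ + ‖W z.1 - W z.2‖) (by fun_prop)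
  have hY2i : IntervalIntegrable (fun s => Y s ^ 2) volume 0 T :=
    hIR (f := fun z => (‖W z.1‖ + ‖W z.1 - W z.2‖) ^ 2) (by fun_prop)
  have hΔ2i : IntervalIntegrable (fun s => ‖W s - W (p s)‖ ^ 2) volume 0 T :=
    hIR (f := fun z => ‖W z.1 - W z.2‖ ^ 2) (by fun_prop)
  have hαi : IntervalIntegrable (fun s => s - p s) volume 0 T :=
    hIR (f := fun z => z.1 - z.2) (by fun_prop)
  set S := ∫ s in (0 : ℝ)..T, Y s ^ 2 with hS
  have hS0 : 0 ≤ S := intervalIntegral.integral_nonneg hT.le fun _ _ => sq_nonneg _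
  have hSPQ : S ≤ 2 * P + 2 * Q := by
    have hPi : IntervalIntegrable (fun s => ‖W s‖ ^ 2) volume 0 T :=
      (by fun_prop : Continuous _).intervalIntegrable _ _
    calc S ≤ ∫ s in (0 : ℝ)..T, (2 * ‖W s‖ ^ 2 + 2 * ‖W s - W (p s)‖ ^ 2) :=
          intervalIntegral.integral_mono_on hT.le hY2i
            ((hPi.const_mul _).add (hΔ2i.const_mul _)) fun s _ => by
              nlinarith [sq_nonneg (‖W s‖ - ‖W s - W (p s)‖)]
      _ = 2 * P + 2 * Q := by
          rw [intervalIntegral.integral_add (hPi.const_mul _) (hΔ2i.const_mul _),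
            intervalIntegral.integral_const_mul, intervalIntegral.integral_const_mul]
  -- Subtracting the noise leaves a path of bounded variation.
  let U : ℝ → E := fun t => X t - ε • W t
  let f : ℝ → E := fun s => ε • (A (W s) - G (W (p s)))
  have hU : Continuous U := by fun_prop
  have hfi : IntervalIntegrable f volume 0 T :=
    hIE (f := fun z => ε • (A (W z.1) - G (W z.2))) (by fun_prop)
  have hUe : ∀ t ∈ Icc 0 T, U t = x₀ + ∫ s in (0 : ℝ)..t, (A (U s) - G (U (p s)) + f s) := by
    intro t ht
    have : ∀ s, A (U s) - G (U (p s)) + f s = A (X s) - G (X (p s)) := fun s => by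
      simp only [U, f, map_sub, map_smul]; module
    simp only [this]
    simp only [U]
    rw [hXe t ht]
    abel
  have hfY : ∀ s, ‖f s‖ ≤ β * Y s := fun s => by
    have h1 : ‖W (p s)‖ ≤ Y s := by
      have := norm_sub_le (W s) (W s - W (p s))
      simpa using this
    have h2 : ‖W s‖ ≤ Y s := le_add_of_nonneg_right (norm_nonneg _)
    calc ‖f s‖ = ε * ‖A (W s) - G (W (p s))‖ := by
          rw [norm_smul, Real.norm_of_nonneg hε0]
      _ ≤ 1 * ‖A (W s) - G (W (p s))‖ := by gcongr
      _ ≤ ‖A (W s)‖ + ‖G (W (p s))‖ := by rw [one_mul]; exact norm_sub_le _ _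
      _ ≤ ‖A‖ * Y s + ‖G‖ * Y s := add_le_add
          ((A.le_opNorm _).trans (by gcongr)) ((G.le_opNorm _).trans (by gcongr))
      _ ≤ β * Y s := by rw [← add_mul]; exact mul_le_mul_of_nonneg_right hAG (hY0 s)
  set D := (R + β * ∫ s in (0 : ℝ)..T, Y s) * V with hD
  have hYI0 : 0 ≤ ∫ s in (0 : ℝ)..T, Y s :=
    intervalIntegral.integral_nonneg hT.le fun s _ => hY0 s
  have hD0 : 0 ≤ D := by positivity
  have hUD : ∀ t ∈ Icc 0 T, ‖U t‖ ≤ D := fun t ht => by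
    refine (norm_le_of_delay_equation hAG hT.le hpT hU hfi hUe t ht).trans ?_
    have h1 : ∫ s in (0 : ℝ)..T, ‖f s‖ ≤ β * ∫ s in (0 : ℝ)..T, Y s := by
      rw [← intervalIntegral.integral_const_mul]
      exact intervalIntegral.integral_mono_on hT.le hfi.norm (hYi.const_mul _) fun s _ => hfY s
    exact mul_le_mul (add_le_add hx₀ h1) (expT t ht) (Real.exp_pos _).le (by positivity)
  have hD2 : D ^ 2 ≤ V ^ 2 * (2 * R ^ 2 + 2 * β ^ 2 * (T * S)) := by
    have h1 := sq_integral_le hT hYi hY2i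
    have h2 : (R + β * ∫ s in (0 : ℝ)..T, Y s) ^ 2
        ≤ 2 * R ^ 2 + 2 * β ^ 2 * (∫ s in (0 : ℝ)..T, Y s) ^ 2 := by
      nlinarith [sq_nonneg (R - β * ∫ s in (0 : ℝ)..T, Y s)]
    have h3 := mul_le_mul_of_nonneg_left h1 (by positivity : 0 ≤ 2 * β ^ 2)
    rw [hD, mul_pow, mul_comm]
    exact mul_le_mul_of_nonneg_left (by linarith) (by positivity)
  -- Increments of the noiseless path since the last sample.
  let J : ℝ → ℝ := fun s => β * D + β * Y s
  have hJi : IntervalIntegrable J volume 0 T := intervalIntegrable_const.add (hYi.const_mul _)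
  have hJ2i : IntervalIntegrable (fun s => J s ^ 2) volume 0 T :=
    hIR (f := fun z => (β * D + β * (‖W z.1‖ + ‖W z.1 - W z.2‖)) ^ 2) (by fun_prop)
  have hJ2 : ∫ s in (0 : ℝ)..T, J s ^ 2 ≤ 2 * β ^ 2 * (T * D ^ 2 + S) := by
    calc ∫ s in (0 : ℝ)..T, J s ^ 2
        ≤ ∫ s in (0 : ℝ)..T, (2 * β ^ 2 * D ^ 2 + 2 * β ^ 2 * Y s ^ 2) :=
          intervalIntegral.integral_mono_on hT.le hJ2i
            (intervalIntegrable_const.add (hY2i.const_mul _)) fun s _ => by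
              simp only [J]; nlinarith [sq_nonneg (β * D - β * Y s)]
      _ = _ := by
          rw [intervalIntegral.integral_add intervalIntegrable_const (hY2i.const_mul _),
            intervalIntegral.integral_const, intervalIntegral.integral_const_mul, smul_eq_mul,
            ← hS]
          ring
  have hUincr : ∀ s ∈ Icc 0 T, ‖U s - U (p s)‖
      ≤ (q * (s - p s) + q⁻¹ * (2 * β ^ 2 * (T * D ^ 2 + S))) / 2 := by
    intro s hs
    have hps := hpT s hs
    have hpsT : p s ∈ Icc 0 T := ⟨hps.1, hps.2.trans hs.2⟩
    have hgi : IntervalIntegrable (fun r => A (U r) - G (U (p r)) + f r) volume 0 T :=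
      (hIE (f := fun z => A (U z.1) - G (U z.2)) (by fun_prop)).add hfi
    have hsub : uIcc (p s) s ⊆ uIcc 0 T := by
      rw [uIcc_of_le hps.2, uIcc_of_le hT.le]; exact Icc_subset_Icc hps.1 hs.2
    have hdiff : U s - U (p s) = ∫ r in (p s)..s, (A (U r) - G (U (p r)) + f r) := by
      rw [hUe s hs, hUe _ hpsT, add_sub_add_left_eq_sub,
        intervalIntegral.integral_interval_sub_left (hgi.mono_set (h0T s hs))
          (hgi.mono_set (h0T _ hpsT))]
    rw [hdiff]
    have h1 : ‖∫ r in (p s)..s, (A (U r) - G (U (p r)) + f r)‖ ≤ ∫ r in (p s)..s, J r := by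
      refine intervalIntegral.norm_integral_le_of_norm_le hps.2 (.of_forall fun r hr => ?_)
        (hJi.mono_set hsub)
      have hrT : r ∈ Icc 0 T := ⟨hps.1.trans hr.1.le, hr.2.trans hs.2⟩
      have hpr := hpT r hrT
      have h2 : ‖A (U r)‖ ≤ ‖A‖ * D := (A.le_opNorm _).trans (by gcongr; exact hUD r hrT)
      have h3 : ‖G (U (p r))‖ ≤ ‖G‖ * D :=
        (G.le_opNorm _).trans (by gcongr; exact hUD _ ⟨hpr.1, hpr.2.trans hrT.2⟩)
      have h4 := mul_le_mul_of_nonneg_right hAG hD0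
      calc _ ≤ ‖A (U r)‖ + ‖G (U (p r))‖ + ‖f r‖ :=
            (norm_add_le _ _).trans (add_le_add_left (norm_sub_le _ _) _)
        _ ≤ J r := by have := hfY r; simp only [J]; linarith
    refine h1.trans ((integral_le_of_subinterval hq hps.1 hps.2 hs.2 hJi hJ2i).trans ?_)
    have := mul_le_mul_of_nonneg_left hJ2 (inv_nonneg.2 hq.le)
    linarith
  -- The error solves a linear equation without delay, forced by `g`.
  let g : ℝ → E := fun s => G (X s - X (p s)) + (ε * c) • G (A (x s) - G (x s))
  have hgi : IntervalIntegrable g volume 0 T :=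
    hIE (f := fun z => G (X z.1 - X z.2) + (ε * c) • G (A (x z.1) - G (x z.1))) (by fun_prop)
  have hxV : ∀ t ∈ Icc 0 T, ‖x t‖ ≤ R * V := fun t ht => by
    have h1 := norm_le_of_delay_equation (f := fun _ => 0) (p := id) hAG hT.le
      (fun s hs => ⟨hs.1, le_rfl⟩) hx intervalIntegrable_const
      (fun t ht => by simpa using hxe t ht) t ht
    simp only [norm_zero, intervalIntegral.integral_zero, add_zero] at h1
    exact h1.trans (mul_le_mul hx₀ (expT t ht) (Real.exp_pos _).le hR)
  have hgbound : ∀ s ∈ Icc 0 T, ‖g s‖ ≤ β * ((q * (s - p s)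
      + q⁻¹ * (2 * β ^ 2 * (T * D ^ 2 + S))) / 2
      + (q * ‖W s - W (p s)‖ ^ 2 + q⁻¹) / 2) + ε * c * (β * (β * (R * V))) := by
    intro s hs
    have h1 : ‖X s - X (p s)‖ ≤ ‖U s - U (p s)‖ + ‖W s - W (p s)‖ := by
      have : X s - X (p s) = (U s - U (p s)) + ε • (W s - W (p s)) := by
        simp only [U]; module
      rw [this]
      refine (norm_add_le _ _).trans (add_le_add_right ?_ _)
      rw [norm_smul, Real.norm_of_nonneg hε0]
      exact mul_le_of_le_one_left (norm_nonneg _) hε1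
    have h2 : ‖W s - W (p s)‖ ≤ (q * ‖W s - W (p s)‖ ^ 2 + q⁻¹) / 2 := by
      have h3 : (q * ‖W s - W (p s)‖ ^ 2 + q⁻¹) / 2 - ‖W s - W (p s)‖
          = q⁻¹ / 2 * (q * ‖W s - W (p s)‖ - 1) ^ 2 := by field_simp; ring
      have : 0 ≤ q⁻¹ / 2 * (q * ‖W s - W (p s)‖ - 1) ^ 2 := by positivity
      linarith
    have h4 : ‖G (X s - X (p s))‖ ≤ β * ‖X s - X (p s)‖ :=
      (G.le_opNorm _).trans (by gcongr)
    have h5 : ‖G (A (x s) - G (x s))‖ ≤ β * (β * (R * V)) := by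
      refine (G.le_opNorm _).trans (mul_le_mul hG ?_ (norm_nonneg _) hβ)
      have h6 : ‖A (x s)‖ ≤ ‖A‖ * (R * V) := (A.le_opNorm _).trans (by gcongr; exact hxV s hs)
      have h7 : ‖G (x s)‖ ≤ ‖G‖ * (R * V) := (G.le_opNorm _).trans (by gcongr; exact hxV s hs)
      have h8 := mul_le_mul_of_nonneg_right hAG (by positivity : 0 ≤ R * V)
      linarith [norm_sub_le (A (x s)) (G (x s))]
    have h9 := hUincr s hs
    refine (norm_add_le _ _).trans (add_le_add (h4.trans ?_) ?_)
    · exact mul_le_mul_of_nonneg_left (by linarith) hβ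
    · rw [norm_smul, Real.norm_of_nonneg (by positivity)]
      exact mul_le_mul_of_nonneg_left h5 (by positivity)
  have hgI : ∫ s in (0 : ℝ)..T, ‖g s‖ ≤ β * ((q * α + T * (q⁻¹ * (2 * β ^ 2 * (T * D ^ 2 + S)))) / 2
      + (q * Q + T * q⁻¹) / 2) + T * (ε * c * (β * (β * (R * V)))) := by
    have i1 := (hαi.const_mul (β * q / 2))
    have i2 := (hΔ2i.const_mul (β * q / 2))
    have i3 : IntervalIntegrable (fun _ : ℝ => β * (q⁻¹ * (2 * β ^ 2 * (T * D ^ 2 + S)) / 2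
      + q⁻¹ / 2) + ε * c * (β * (β * (R * V)))) volume 0 T := intervalIntegrable_const
    calc ∫ s in (0 : ℝ)..T, ‖g s‖
        ≤ ∫ s in (0 : ℝ)..T, (β * q / 2 * (s - p s) + β * q / 2 * ‖W s - W (p s)‖ ^ 2
          + (β * (q⁻¹ * (2 * β ^ 2 * (T * D ^ 2 + S)) / 2
            + q⁻¹ / 2) + ε * c * (β * (β * (R * V))))) :=
          intervalIntegral.integral_mono_on hT.le hgi.norm ((i1.add i2).add i3) fun s hs =>
            (hgbound s hs).trans (le_of_eq (by ring))
      _ = _ := by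
          rw [intervalIntegral.integral_add (i1.add i2) i3, intervalIntegral.integral_add i1 i2,
            intervalIntegral.integral_const_mul, intervalIntegral.integral_const_mul,
            intervalIntegral.integral_const, smul_eq_mul]
          ring
  have herr : ∀ t ∈ Icc 0 T, X t - x t - ε • Z t = 0 + ∫ s in (0 : ℝ)..t,
      (A (X s - x s - ε • Z s) - G (X s - x s - ε • Z s) + g s) := by
    intro t ht
    have jX : IntervalIntegrable (fun s => A (X s) - G (X (p s))) volume 0 t :=
      (hIE (f := fun z => A (X z.1) - G (X z.2)) (by fun_prop)).mono_set (h0T t ht)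
    have jx : IntervalIntegrable (fun s => A (x s) - G (x s)) volume 0 t :=
      (by fun_prop : Continuous _).intervalIntegrable _ _
    have jZ : IntervalIntegrable (fun s => ε • (A (Z s) - G (Z s))) volume 0 t :=
      (by fun_prop : Continuous _).intervalIntegrable _ _
    have jG : IntervalIntegrable (fun s => (ε * c) • G (A (x s) - G (x s))) volume 0 t :=
      (by fun_prop : Continuous _).intervalIntegrable _ _
    have hcongr : ∀ s, A (X s - x s - ε • Z s) - G (X s - x s - ε • Z s) + g s
        = (A (X s) - G (X (p s))) - (A (x s) - G (x s)) - ε • (A (Z s) - G (Z s))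
          + (ε * c) • G (A (x s) - G (x s)) := fun s => by
      simp only [g, map_sub, map_smul]; module
    simp only [hcongr]
    rw [intervalIntegral.integral_add ((jX.sub jx).sub jZ) jG,
      intervalIntegral.integral_sub (jX.sub jx) jZ,
      intervalIntegral.integral_sub jX jx, intervalIntegral.integral_smul,
      intervalIntegral.integral_smul, G.intervalIntegral_comp_comm jx, hXe t ht, hxe t ht,
      hZe t ht]
    module
  intro t ht
  have hfin := norm_le_of_delay_equation (p := id) hAG hT.le (fun s hs => ⟨hs.1, le_rfl⟩)
    (by fun_prop : Continuous fun t => X t - x t - ε • Z t) hgi herr t ht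
  rw [norm_zero, zero_add] at hfin
  have hgI0 : 0 ≤ ∫ s in (0 : ℝ)..T, ‖g s‖ :=
    intervalIntegral.integral_nonneg hT.le fun _ _ => norm_nonneg _
  refine (hfin.trans (mul_le_mul_of_nonneg_left (expT t ht) hgI0)).trans ?_
  have hDS : T * D ^ 2 + S ≤ (T * (V ^ 2 * (2 * R ^ 2 + 4 * β ^ 2 * T)) + 2) * (1 + P + Q) := by
    have e1 : T * D ^ 2 ≤ T * (V ^ 2 * (2 * R ^ 2 + 2 * β ^ 2 * (T * S))) := by gcongr
    have e2 : V ^ 2 * (2 * R ^ 2 + 2 * β ^ 2 * (T * S))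
        ≤ V ^ 2 * ((2 * R ^ 2 + 4 * β ^ 2 * T) * (1 + P + Q)) := by
      refine mul_le_mul_of_nonneg_left ?_ (by positivity)
      have e3 : 2 * β ^ 2 * (T * S) ≤ 2 * β ^ 2 * (T * (2 * P + 2 * Q)) := by gcongr
      have e4 : 0 ≤ 2 * R ^ 2 * (P + Q) + 4 * β ^ 2 * T := by positivity
      linarith
    have e5 := mul_le_mul_of_nonneg_left e2 hT.le
    linarith
  set N := 1 + P + Q
  have hN : 1 ≤ N := by simp only [N]; linarith
  have hqi : 0 < q⁻¹ := inv_pos.2 hq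
  set c₁ := T * (V ^ 2 * (2 * R ^ 2 + 4 * β ^ 2 * T)) + 2
  have hc₁ : 0 ≤ c₁ := by positivity
  have k1 : ∫ s in (0 : ℝ)..T, ‖g s‖ ≤ β * (q * (α + Q)) + T * β ^ 3 * c₁ * (q⁻¹ * N)
      + β * T * (q⁻¹ * N) + β ^ 2 * T * R * V * (ε * c) := by
    have m1 : β * (q⁻¹ * (β ^ 2 * (T * D ^ 2 + S)) * T) ≤ β * (q⁻¹ * (β ^ 2 * (c₁ * N)) * T) := by
      gcongr
    have m2 : β * (T * q⁻¹) * 1 ≤ β * (T * q⁻¹) * N := by gcongr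
    have m3 : 0 ≤ β * (q * (α + Q)) := by positivity
    have m4 : 0 ≤ β * (T * q⁻¹) * N := by positivity
    linarith
  have z1 : 0 ≤ q * (α + Q) := by positivity
  have z2 : 0 ≤ q⁻¹ * N := by positivity
  have z3 : 0 ≤ ε * c := by positivity
  have k2 := mul_le_mul_of_nonneg_right k1 hV0.le
  refine k2.trans ?_
  set z₁ := q * (α + Q)
  set z₂ := q⁻¹ * N
  set z₃ := ε * c
  have d1 : β ≤ β + T * β ^ 3 * c₁ + β * T + β ^ 2 * T * R * V := by
    have : 0 ≤ T * β ^ 3 * c₁ + β * T + β ^ 2 * T * R * V := by positivity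
    linarith
  have d2 : T * β ^ 3 * c₁ + β * T ≤ β + T * β ^ 3 * c₁ + β * T + β ^ 2 * T * R * V := by
    have : 0 ≤ β + β ^ 2 * T * R * V := by positivity
    linarith
  have d3 : β ^ 2 * T * R * V ≤ β + T * β ^ 3 * c₁ + β * T + β ^ 2 * T * R * V := by
    have : 0 ≤ β + T * β ^ 3 * c₁ + β * T := by positivity
    linarith
  set Cc := β + T * β ^ 3 * c₁ + β * T + β ^ 2 * T * R * V
  have f1 := mul_le_mul_of_nonneg_right d1 z1
  have f2 := mul_le_mul_of_nonneg_right d2 z2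
  have f3 := mul_le_mul_of_nonneg_right d3 z3
  have f4 : β * z₁ + T * β ^ 3 * c₁ * z₂ + β * T * z₂ + β ^ 2 * T * R * V * z₃
      ≤ Cc * (z₁ + z₂ + z₃) := by linarith
  have f5 := mul_le_mul_of_nonneg_right f4 hV0.le
  linarith

end

/-! ### The renewal sampling times -/

section

variable {Ω : Type*}

@[simp] lemma samplingTime_zero (ξ : ℕ → Ω → ℝ) (n : ℕ) (ω : Ω) : samplingTime ξ n 0 ω = 0 := by
  simp [samplingTime]

lemma samplingTime_succ (ξ : ℕ → Ω → ℝ) (n k : ℕ) (ω : Ω) :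
    samplingTime ξ n (k + 1) ω = samplingTime ξ n k ω + ξ k ω / n := by
  simp [samplingTime, Finset.sum_range_succ]

lemma monotone_samplingTime {ξ : ℕ → Ω → ℝ} {ω : Ω} (hpos : ∀ i, 0 < ξ i ω) (n : ℕ) :
    Monotone fun k => samplingTime ξ n k ω :=
  monotone_nat_of_le_succ fun k => by
    rw [samplingTime_succ]
    have := (hpos k).le
    have : 0 ≤ ξ k ω / n := by positivity
    linarith

lemma samplingTime_renewalCount_le {ξ : ℕ → Ω → ℝ} {n : ℕ} {ω : Ω} {s : ℝ} (hs : 0 ≤ s)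
    (hfin : BddAbove {k | samplingTime ξ n k ω ≤ s}) :
    samplingTime ξ n (renewalCount ξ n s ω) ω ≤ s :=
  Nat.sSup_mem (s := {k | samplingTime ξ n k ω ≤ s}) ⟨0, by simpa using hs⟩ hfin

lemma lt_samplingTime_renewalCount_succ {ξ : ℕ → Ω → ℝ} {n : ℕ} {ω : Ω} {s : ℝ}
    (hfin : BddAbove {k | samplingTime ξ n k ω ≤ s}) :
    s < samplingTime ξ n (renewalCount ξ n s ω + 1) ω := by
  by_contra h
  exact (Nat.lt_succ_self _).not_ge (le_csSup hfin (not_lt.1 h))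

lemma lastSample_mem {ξ : ℕ → Ω → ℝ} {n : ℕ} {ω : Ω} {s : ℝ} (hs : 0 ≤ s)
    (hpos : ∀ i, 0 < ξ i ω) (hfin : BddAbove {k | samplingTime ξ n k ω ≤ s}) :
    lastSample ξ n s ω ∈ Icc 0 s :=
  ⟨by simpa [lastSample] using monotone_samplingTime hpos n (Nat.zero_le (renewalCount ξ n s ω)),
    samplingTime_renewalCount_le hs hfin⟩

/-- The last sampling time before `s`, written as a countable supremum. It is jointly measurable
in `(s, ω)` with no exceptional set, and it agrees with `lastSample` for `s ≥ 0` whenever the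
inter-sampling times are positive and do not accumulate. -/
noncomputable def supSample (ξ : ℕ → Ω → ℝ) (n : ℕ) (s : ℝ) (ω : Ω) : ℝ :=
  ⨆ k, if samplingTime ξ n k ω ≤ s then samplingTime ξ n k ω else 0

lemma supSample_eq_lastSample {ξ : ℕ → Ω → ℝ} {n : ℕ} {ω : Ω} {s : ℝ} (hs : 0 ≤ s)
    (hpos : ∀ i, 0 < ξ i ω) (hfin : BddAbove {k | samplingTime ξ n k ω ≤ s}) :
    supSample ξ n s ω = lastSample ξ n s ω := by
  have hmem := lastSample_mem hs hpos hfin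
  have hle : ∀ k, (if samplingTime ξ n k ω ≤ s then samplingTime ξ n k ω else 0)
      ≤ lastSample ξ n s ω := fun k => by
    split_ifs with h
    · exact monotone_samplingTime hpos n (le_csSup hfin h)
    · exact hmem.1
  refine le_antisymm (ciSup_le hle) ?_
  refine (le_of_eq ?_).trans (le_ciSup ⟨_, forall_mem_range.2 hle⟩ (renewalCount ξ n s ω))
  rw [if_pos (samplingTime_renewalCount_le hs hfin), lastSample]

/-- Elapsed time `s - π s` is at most the length of the current inter-sampling interval. -/
lemma age_le_tsum {ξ : ℕ → Ω → ℝ} {n : ℕ} {ω : Ω} {s T : ℝ} (hs : s ∈ Icc 0 T)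
    (hfin : BddAbove {k | samplingTime ξ n k ω ≤ s}) :
    ENNReal.ofReal (s - lastSample ξ n s ω) ≤ ∑' k, if samplingTime ξ n k ω ≤ T then
      (Ico (samplingTime ξ n k ω) (samplingTime ξ n (k + 1) ω)).indicator
        (fun _ => ENNReal.ofReal (ξ k ω / n)) s else 0 := by
  refine le_trans ?_ (ENNReal.le_tsum (renewalCount ξ n s ω))
  have h1 := samplingTime_renewalCount_le hs.1 hfin
  have h2 := lt_samplingTime_renewalCount_succ hfin
  rw [if_pos (h1.trans hs.2), indicator_of_mem (show s ∈ Ico _ _ from ⟨h1, h2⟩)]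
  refine ENNReal.ofReal_le_ofReal ?_
  rw [samplingTime_succ] at h2
  unfold lastSample
  linarith

lemma lintegral_age_le_tsum {ξ : ℕ → Ω → ℝ} {n : ℕ} {ω : Ω} {T : ℝ}
    (hpos : ∀ i, 0 < ξ i ω) (hfin : ∀ s, BddAbove {k | samplingTime ξ n k ω ≤ s}) :
    ∫⁻ s in Icc 0 T, ENNReal.ofReal (s - lastSample ξ n s ω)
      ≤ ∑' k, if samplingTime ξ n k ω ≤ T then ENNReal.ofReal ((ξ k ω / n) ^ 2) else 0 := by
  calc ∫⁻ s in Icc 0 T, ENNReal.ofReal (s - lastSample ξ n s ω)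
      ≤ ∫⁻ s in Icc 0 T, ∑' k, if samplingTime ξ n k ω ≤ T then
          (Ico (samplingTime ξ n k ω) (samplingTime ξ n (k + 1) ω)).indicator
          (fun _ => ENNReal.ofReal (ξ k ω / n)) s else 0 :=
        setLIntegral_mono' measurableSet_Icc fun s hs => age_le_tsum hs (hfin s)
    _ ≤ ∫⁻ s, ∑' k, if samplingTime ξ n k ω ≤ T then
          (Ico (samplingTime ξ n k ω) (samplingTime ξ n (k + 1) ω)).indicator
          (fun _ => ENNReal.ofReal (ξ k ω / n)) s else 0 := setLIntegral_le_lintegral _ _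
    _ = ∑' k, ∫⁻ s, if samplingTime ξ n k ω ≤ T then
          (Ico (samplingTime ξ n k ω) (samplingTime ξ n (k + 1) ω)).indicator
          (fun _ => ENNReal.ofReal (ξ k ω / n)) s else 0 := by
        refine lintegral_tsum fun k => ?_
        split_ifs
        · exact (measurable_const.indicator measurableSet_Ico).aemeasurable
        · exact aemeasurable_const
    _ = _ := by
        refine tsum_congr fun k => ?_
        split_ifs
        · rw [lintegral_indicator_const measurableSet_Ico, Real.volume_Ico, samplingTime_succ,
            add_sub_cancel_left, sq, ENNReal.ofReal_mul (div_nonneg (hpos k).le n.cast_nonneg)]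
        · simp

/-- The truncated interval lengths that start before time `T` add up to at most `n T + 1`. -/
lemma sum_min_one_le {ξ : ℕ → Ω → ℝ} {n : ℕ} (hn : 0 < n) {ω : Ω} {T : ℝ} (hT : 0 ≤ T)
    (hpos : ∀ i, 0 < ξ i ω) (k : ℕ) :
    (∑ i ∈ Finset.range k, if samplingTime ξ n i ω ≤ T then min (ξ i ω) 1 else 0)
      ≤ min (n * samplingTime ξ n k ω) (n * T + 1) := by
  have hn' : (0 : ℝ) < n := by exact_mod_cast hn
  induction k with
  | zero => simp; positivity
  | succ k ih =>
    rw [Finset.sum_range_succ]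
    have h1 : (n : ℝ) * samplingTime ξ n (k + 1) ω = n * samplingTime ξ n k ω + ξ k ω := by
      rw [samplingTime_succ]; field_simp
    rw [h1]
    obtain ⟨ih1, ih2⟩ := le_min_iff.1 ih
    have hk := hpos k
    split_ifs with h
    · have h2 : (n : ℝ) * samplingTime ξ n k ω ≤ n * T := by gcongr
      exact le_min (add_le_add ih1 (min_le_left _ _))
        ((add_le_add (ih1.trans h2) (min_le_right _ _)))
    · rw [add_zero]
      exact le_min (by linarith) ih2

variable [MeasurableSpace Ω] {P : Measure Ω} {ν : Measure ℝ} {ξ : ℕ → Ω → ℝ}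

lemma measurable_samplingTime (hξ : ∀ i, Measurable (ξ i)) (n k : ℕ) :
    Measurable (samplingTime ξ n k) := by
  unfold samplingTime
  exact Finset.measurable_sum _ fun i _ => (hξ i).div_const _

lemma measurable_supSample (hξ : ∀ i, Measurable (ξ i)) (n : ℕ) {α : Type*} [MeasurableSpace α]
    {σ : α → ℝ} {g : α → Ω} (hσ : Measurable σ) (hg : Measurable g) :
    Measurable fun a => supSample ξ n (σ a) (g a) := by
  unfold supSample
  refine Measurable.iSup fun k => ?_
  have h : Measurable fun a => samplingTime ξ n k (g a) :=
    (measurable_samplingTime hξ n k).comp hg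
  exact Measurable.ite (measurableSet_le h hσ) h measurable_const

lemma IsIID.ae_pos (hξ : IsIID ξ ν P) (hν : IsSamplingLaw ν) : ∀ᵐ ω ∂P, ∀ i, 0 < ξ i ω :=
  ae_all_iff.2 fun i => by
    have h := hν.pos
    rw [← (hξ.law i).map_eq] at h
    exact ae_of_ae_map (hξ.measurable i).aemeasurable h

lemma IsIID.measurable_ite (hξ : IsIID ξ ν P) (n k : ℕ) (T : ℝ) {φ : ℝ → ℝ≥0∞}
    (hφ : Measurable φ) :
    Measurable fun ω => if samplingTime ξ n k ω ≤ T then φ (ξ k ω) else 0 :=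
  Measurable.ite (measurableSet_le (measurable_samplingTime hξ.measurable n k) measurable_const)
    (hφ.comp (hξ.measurable k)) measurable_const

/-- The event `{τ_k ≤ T}` depends on the first `k` inter-sampling times only, hence is independent
of the next one. -/
lemma IsIID.lintegral_ite (hξ : IsIID ξ ν P) (n k : ℕ) (T : ℝ) {φ : ℝ → ℝ≥0∞} (hφ : Measurable φ) :
    ∫⁻ ω, (if samplingTime ξ n k ω ≤ T then φ (ξ k ω) else 0) ∂P
      = P {ω | samplingTime ξ n k ω ≤ T} * ∫⁻ x, φ x ∂ν := by
  have hset : MeasurableSet {ω | samplingTime ξ n k ω ≤ T} :=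
    measurableSet_le (measurable_samplingTime hξ.measurable n k) measurable_const
  have hind : IndepFun (∑ i ∈ Finset.range k, ξ i) (ξ k) P :=
    hξ.indep.indepFun_finsetSum_of_notMem hξ.measurable (by simp)
  let ψ : ℝ → ℝ≥0∞ := fun y => if y / n ≤ T then 1 else 0
  have hψ : Measurable ψ :=
    Measurable.ite (measurableSet_le (by fun_prop) measurable_const) measurable_const
      measurable_const
  have hτ : ∀ ω, ψ ((∑ i ∈ Finset.range k, ξ i) ω)
      = {ω | samplingTime ξ n k ω ≤ T}.indicator 1 ω := fun ω => by
    simp [ψ, indicator_apply, samplingTime, Finset.sum_div]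
  have h1 : ∀ ω, (if samplingTime ξ n k ω ≤ T then φ (ξ k ω) else 0)
      = ψ ((∑ i ∈ Finset.range k, ξ i) ω) * φ (ξ k ω) := fun ω => by
    rw [hτ, indicator_apply]
    simp only [mem_ofPred_eq, Pi.one_apply, ite_mul, one_mul, zero_mul]
  have hsum : Measurable (∑ i ∈ Finset.range k, ξ i) := by
    simpa only [← Finset.sum_fn] using Finset.measurable_sum _ fun i _ => hξ.measurable i
  have h2 := lintegral_mul_eq_lintegral_mul_lintegral_of_indepFun (hψ.comp hsum)
    (hφ.comp (hξ.measurable k)) (hind.comp hψ hφ)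
  simp only [h1]
  simp only [Pi.mul_apply, Function.comp_apply] at h2
  rw [h2, (hξ.law k).lintegral_comp hφ.aemeasurable]
  simp only [hτ]
  rw [lintegral_indicator_one hset]

/-- A version of Wald's identity: it bounds the renewal function `∑ P(τ_k ≤ T)` without any limit
theorem for the renewal process. -/
lemma IsIID.tsum_measure_mul_le [IsProbabilityMeasure P] (hξ : IsIID ξ ν P) (hν : IsSamplingLaw ν)
    {n : ℕ} (hn : 0 < n) {T : ℝ} (hT : 0 ≤ T) :
    (∑' k, P {ω | samplingTime ξ n k ω ≤ T}) * ∫⁻ x, ENNReal.ofReal (min x 1) ∂ν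
      ≤ ENNReal.ofReal (n * T + 1) := by
  have hφ : Measurable fun x : ℝ => ENNReal.ofReal (min x 1) := by fun_prop
  rw [← ENNReal.tsum_mul_right]
  simp only [← hξ.lintegral_ite n _ T hφ]
  rw [← lintegral_tsum fun k => (hξ.measurable_ite n k T hφ).aemeasurable]
  calc _ ≤ ∫⁻ _, ENNReal.ofReal (n * T + 1) ∂P := by
        refine lintegral_mono_ae ?_
        filter_upwards [hξ.ae_pos hν] with ω hω
        refine ENNReal.tsum_le_of_sum_range_le fun k => ?_
        have h0 : ∀ i, (0 : ℝ) ≤ if samplingTime ξ n i ω ≤ T then min (ξ i ω) 1 else 0 :=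
          fun i => by
            have := (hω i).le
            split_ifs <;> positivity
        have h1 : ∀ i, (if samplingTime ξ n i ω ≤ T then ENNReal.ofReal (min (ξ i ω) 1) else 0)
            = ENNReal.ofReal (if samplingTime ξ n i ω ≤ T then min (ξ i ω) 1 else 0) :=
          fun i => by split_ifs <;> simp
        simp only [h1]
        rw [← ENNReal.ofReal_sum_of_nonneg fun i _ => h0 i]
        exact ENNReal.ofReal_le_ofReal ((sum_min_one_le hn hT hω k).trans (min_le_right _ _))
    _ = _ := by simp

lemma IsSamplingLaw.lintegral_min_one_ne_zero (hν : IsSamplingLaw ν) :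
    ∫⁻ x, ENNReal.ofReal (min x 1) ∂ν ≠ 0 := by
  have := hν.prob
  intro h
  rw [lintegral_eq_zero_iff (by fun_prop)] at h
  have hF : ∀ᵐ _ ∂ν, False := by
    filter_upwards [h, hν.pos] with x hx hx0
    have : 0 < min x 1 := lt_min hx0 one_pos
    simp only [Pi.zero_apply, ENNReal.ofReal_eq_zero] at hx
    linarith
  exact IsProbabilityMeasure.ne_zero ν (by simpa using hF)

lemma IsSamplingLaw.lintegral_sq_ne_top (hν : IsSamplingLaw ν) :
    ∫⁻ x, ENNReal.ofReal (x ^ 2) ∂ν ≠ ∞ := by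
  have h1 : Integrable (fun x : ℝ => x ^ 2) ν := by
    refine ((hν.mgf_finite 1).const_mul 2).mono' (by fun_prop) ?_
    filter_upwards [hν.pos] with x hx
    have := Real.quadratic_le_exp_of_nonneg hx.le
    rw [Real.norm_of_nonneg (by positivity), one_mul]
    nlinarith
  exact (h1.lintegral_lt_top).ne

/-- Almost surely the sampling times do not accumulate. -/
lemma IsIID.ae_bddAbove [IsProbabilityMeasure P] (hξ : IsIID ξ ν P) (hν : IsSamplingLaw ν)
    {n : ℕ} (hn : 0 < n) : ∀ᵐ ω ∂P, ∀ s, BddAbove {k | samplingTime ξ n k ω ≤ s} := by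
  have h : ∀ᵐ ω ∂P, ∀ T : ℕ, ∀ᶠ k in atTop, ω ∉ {ω | samplingTime ξ n k ω ≤ T} := by
    refine ae_all_iff.2 fun T => ae_eventually_notMem fun htop => ?_
    have h1 := hξ.tsum_measure_mul_le hν hn (T := T) T.cast_nonneg
    rw [htop, ENNReal.top_mul hν.lintegral_min_one_ne_zero] at h1
    exact ENNReal.ofReal_ne_top (top_le_iff.1 h1)
  filter_upwards [h] with ω hω s
  obtain ⟨T, hT⟩ := exists_nat_ge s
  obtain ⟨N, hN⟩ := eventually_atTop.1 (hω T)
  refine ⟨N, fun k hk => ?_⟩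
  by_contra hlt
  exact hN k (not_le.1 hlt).le (le_trans (show samplingTime ξ n k ω ≤ s from hk) hT)

/-- The constant in the bound `E ∫₀ᵀ (s - π s) ds ≤ ageConst ν T / n`. -/
noncomputable def ageConst (ν : Measure ℝ) (T : ℝ) : ℝ≥0∞ :=
  ENNReal.ofReal (T + 1) / (∫⁻ x, ENNReal.ofReal (min x 1) ∂ν) * ∫⁻ x, ENNReal.ofReal (x ^ 2) ∂ν

lemma IsSamplingLaw.ageConst_ne_top (hν : IsSamplingLaw ν) (T : ℝ) : ageConst ν T ≠ ∞ :=
  ENNReal.mul_ne_top (ENNReal.div_ne_top ENNReal.ofReal_ne_top hν.lintegral_min_one_ne_zero)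
    hν.lintegral_sq_ne_top

lemma IsIID.lintegral_age_le [IsProbabilityMeasure P] (hξ : IsIID ξ ν P) (hν : IsSamplingLaw ν)
    {n : ℕ} (hn : 0 < n) {T : ℝ} (hT : 0 ≤ T) :
    ∫⁻ ω, (∫⁻ s in Icc 0 T, ENNReal.ofReal (s - supSample ξ n s ω)) ∂P
      ≤ ENNReal.ofReal ((n : ℝ)⁻¹) * ageConst ν T := by
  have hn1 : (1 : ℝ) ≤ n := by exact_mod_cast hn
  have hφ : Measurable fun x : ℝ => ENNReal.ofReal ((x / n) ^ 2) := by fun_prop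
  have hfin : ∫⁻ x, ENNReal.ofReal (min x 1) ∂ν ≠ ∞ := by
    have := hν.prob
    refine ne_top_of_le_ne_top (b := 1) ENNReal.one_ne_top ?_
    calc _ ≤ ∫⁻ _, 1 ∂ν := lintegral_mono fun x => by simp
      _ = 1 := by simp
  calc ∫⁻ ω, (∫⁻ s in Icc 0 T, ENNReal.ofReal (s - supSample ξ n s ω)) ∂P
      ≤ ∫⁻ ω, ∑' k, (if samplingTime ξ n k ω ≤ T then
          ENNReal.ofReal ((ξ k ω / n) ^ 2) else 0) ∂P := by
        refine lintegral_mono_ae ?_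
        filter_upwards [hξ.ae_pos hν, hξ.ae_bddAbove hν hn] with ω h1 h2
        refine le_trans (le_of_eq ?_) (lintegral_age_le_tsum h1 h2)
        exact setLIntegral_congr_fun measurableSet_Icc fun s hs => by
          simp only [supSample_eq_lastSample hs.1 h1 (h2 s)]
    _ = ∑' k, P {ω | samplingTime ξ n k ω ≤ T} * ∫⁻ x, ENNReal.ofReal ((x / n) ^ 2) ∂ν := by
        rw [lintegral_tsum fun k => (hξ.measurable_ite n k T hφ).aemeasurable]
        exact tsum_congr fun k => hξ.lintegral_ite n k T hφ
    _ = (∑' k, P {ω | samplingTime ξ n k ω ≤ T}) *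
          (ENNReal.ofReal ((n : ℝ)⁻¹ ^ 2) * ∫⁻ x, ENNReal.ofReal (x ^ 2) ∂ν) := by
        rw [ENNReal.tsum_mul_right, ← lintegral_const_mul (ENNReal.ofReal ((n : ℝ)⁻¹ ^ 2)) (by fun_prop)]
        congr 1
        refine lintegral_congr fun x => ?_
        rw [← ENNReal.ofReal_mul (by positivity)]
        congr 1
        ring
    _ ≤ ENNReal.ofReal (n * T + 1) / (∫⁻ x, ENNReal.ofReal (min x 1) ∂ν) *
          (ENNReal.ofReal ((n : ℝ)⁻¹ ^ 2) * ∫⁻ x, ENNReal.ofReal (x ^ 2) ∂ν) := by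
        gcongr
        exact (ENNReal.le_div_iff_mul_le (.inl hν.lintegral_min_one_ne_zero) (.inl hfin)).2
          (hξ.tsum_measure_mul_le hν hn hT)
    _ = ENNReal.ofReal ((n * T + 1) * (n : ℝ)⁻¹ ^ 2) / (∫⁻ x, ENNReal.ofReal (min x 1) ∂ν) *
          ∫⁻ x, ENNReal.ofReal (x ^ 2) ∂ν := by
        rw [ENNReal.ofReal_mul (by positivity), div_eq_mul_inv, div_eq_mul_inv]
        ring
    _ ≤ ENNReal.ofReal ((n : ℝ)⁻¹ * (T + 1)) / (∫⁻ x, ENNReal.ofReal (min x 1) ∂ν) *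
          ∫⁻ x, ENNReal.ofReal (x ^ 2) ∂ν := by
        have h1 : (n * T + 1) * (n : ℝ)⁻¹ ^ 2 = (n : ℝ)⁻¹ * (T + (n : ℝ)⁻¹) := by field_simp
        rw [h1]
        gcongr
        exact inv_le_one_of_one_le₀ hn1
    _ = _ := by
        rw [ageConst, ENNReal.ofReal_mul (by positivity), div_eq_mul_inv, div_eq_mul_inv]
        ring

end

/-! ### Brownian increments up to an independent random time -/

section

variable {Ω : Type*} [MeasurableSpace Ω] {P : Measure Ω} {d : ℕ}
  {W : ℝ≥0 → Ω → EuclideanSpace ℝ (Fin d)}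

lemma IsBrownianMotion.ae_continuous (hW : IsBrownianMotion W P) :
    ∀ᵐ ω ∂P, Continuous fun t => W t ω := by
  filter_upwards [ae_all_iff.2 fun i => (hW.coord i).cont] with ω hω
  exact (PiLp.continuous_toLp 2 fun _ : Fin d => ℝ).comp (continuous_pi hω)

lemma IsBrownianMotion.exists_continuous_version (hW : IsBrownianMotion W P) :
    ∃ W' : ℝ≥0 → Ω → EuclideanSpace ℝ (Fin d), (∀ t, Measurable (W' t)) ∧
      (∀ ω, Continuous fun t => W' t ω) ∧ ∀ᵐ ω ∂P, ∀ t, W' t ω = W t ω := by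
  classical
  set N := toMeasurable P {ω | ¬ Continuous fun t => W t ω}
  have hN0 : P N = 0 := by rw [measure_toMeasurable]; exact hW.ae_continuous
  have hN : MeasurableSet N := measurableSet_toMeasurable _ _
  refine ⟨fun t ω => if ω ∈ N then 0 else W t ω,
    fun t => Measurable.ite hN measurable_const (hW.measurable t), fun ω => ?_, ?_⟩
  · by_cases h : ω ∈ N
    · simp only [h, if_true]; exact continuous_const
    · simp only [h, if_false]
      by_contra hc
      exact h (subset_toMeasurable _ _ hc)
  · filter_upwards [measure_eq_zero_iff_ae_notMem.1 hN0] with ω hω t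
    rw [if_neg hω]

lemma lintegral_sq_gaussianReal (v : ℝ≥0) :
    ∫⁻ x, ENNReal.ofReal (x ^ 2) ∂(gaussianReal 0 v) = v := by
  have hint : Integrable (fun x : ℝ => x ^ 2) (gaussianReal 0 v) :=
    (memLp_id_gaussianReal (μ := 0) (v := v) 2).integrable_sq
  rw [← ofReal_integral_eq_lintegral_ofReal hint (.of_forall fun x => sq_nonneg x)]
  have h := variance_fun_id_gaussianReal (μ := 0) (v := v)
  rw [variance_eq_integral (by fun_prop)] at h
  simp only [integral_id_gaussianReal, sub_zero] at h
  rw [h]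
  simp

lemma enorm_sq_eq_sum (v : EuclideanSpace ℝ (Fin d)) :
    ‖v‖ₑ ^ 2 = ∑ i, ENNReal.ofReal (v i ^ 2) := by
  rw [← ENNReal.ofReal_sum_of_nonneg fun i _ => sq_nonneg _, ← EuclideanSpace.real_norm_sq_eq,
    ENNReal.ofReal_pow (norm_nonneg _), ofReal_norm]

lemma IsBrownianMotion.lintegral_increment (hW : IsBrownianMotion W P) (s r : ℝ≥0) :
    ∫⁻ ω, ‖W s ω - W r ω‖ₑ ^ 2 ∂P = d * ENNReal.ofReal |(s : ℝ) - r| := by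
  simp only [enorm_sq_eq_sum, PiLp.sub_apply]
  have hm : ∀ (t : ℝ≥0) (i : Fin d), Measurable fun ω => W t ω i := fun t i =>
    (by fun_prop : Measurable fun v : EuclideanSpace ℝ (Fin d) => v i).comp (hW.measurable t)
  have hm' : ∀ i : Fin d, Measurable fun ω => ENNReal.ofReal ((W s ω i - W r ω i) ^ 2) := fun i =>
    (((hm s i).sub (hm r i)).pow_const 2).ennreal_ofReal
  rw [lintegral_finsetSum _ fun i _ => hm' i]
  have h : ∀ i : Fin d, ∫⁻ ω, ENNReal.ofReal ((W s ω i - W r ω i) ^ 2) ∂P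
      = ENNReal.ofReal |(s : ℝ) - r| := fun i => by
    have h1 := ((hW.coord i).hasLaw_sub s r).lintegral_comp
      (f := fun x => ENNReal.ofReal (x ^ 2)) (by fun_prop)
    simp only [Pi.sub_apply] at h1
    rw [h1, lintegral_sq_gaussianReal, ← Real.dist_eq, ← edist_dist, edist_nndist]
    rfl
  simp [h]

lemma IsBrownianMotion.lintegral_eval (hW : IsBrownianMotion W P) (s : ℝ≥0) :
    ∫⁻ ω, ‖W s ω‖ₑ ^ 2 ∂P = d * ENNReal.ofReal s := by
  have h0 : ∀ᵐ ω ∂P, W 0 ω = 0 := by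
    filter_upwards [ae_all_iff.2 fun i => (hW.coord i).eval_zero_ae_eq_zero] with ω hω
    ext i
    exact hω i
  have h := hW.lintegral_increment s 0
  simp only [NNReal.coe_zero, sub_zero, NNReal.abs_eq] at h
  rw [← h]
  refine lintegral_congr_ae ?_
  filter_upwards [h0] with ω hω
  rw [hω, sub_zero]

/-- The increment bound transfers to a random time `v (N ω)` independent of the process with values
in a countable set: condition on the value of `N`. -/
lemma lintegral_increment_discrete_le {D : ℝ≥0∞} (hWm : ∀ t, Measurable (W t))
    (hinc : ∀ s r, ∫⁻ ω, ‖W s ω - W r ω‖ₑ ^ 2 ∂P ≤ D * ENNReal.ofReal |(s : ℝ) - r|)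
    {N : Ω → ℕ} (hN : Measurable N) (hind : IndepFun N (fun ω t => W t ω) P)
    (s : ℝ≥0) (v : ℕ → ℝ≥0) :
    (Measurable fun ω => ‖W s ω - W (v (N ω)) ω‖ₑ ^ 2) ∧
      ∫⁻ ω, ‖W s ω - W (v (N ω)) ω‖ₑ ^ 2 ∂P
        ≤ D * ∫⁻ ω, ENNReal.ofReal |(s : ℝ) - v (N ω)| ∂P := by
  let φ : ℕ → ℕ → ℝ≥0∞ := fun j k => if k = j then 1 else 0
  let ψ : ℕ → (ℝ≥0 → EuclideanSpace ℝ (Fin d)) → ℝ≥0∞ := fun j w => ‖w s - w (v j)‖ₑ ^ 2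
  have hφ : ∀ j, Measurable (φ j) := fun j => measurable_of_countable _
  have hψ : ∀ j, Measurable (ψ j) := fun j =>
    (((measurable_pi_apply s).sub (measurable_pi_apply (v j))).enorm.pow_const 2)
  have hψi : ∀ j, ∫⁻ ω, ψ j (fun t => W t ω) ∂P = ∫⁻ ω, ‖W s ω - W (v j) ω‖ₑ ^ 2 ∂P := fun _ => rfl
  have hWp : Measurable fun ω t => W t ω := measurable_pi_lambda _ hWm
  have hsplit : ∀ g : ℕ → ℝ≥0∞, ∀ ω, g (N ω) = ∑' j, φ j (N ω) * g j := fun g ω => by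
    rw [tsum_eq_single (N ω) fun j hj => by simp [φ, hj.symm]]
    simp [φ]
  have h1 : (fun ω => ‖W s ω - W (v (N ω)) ω‖ₑ ^ 2)
      = fun ω => ∑' j, φ j (N ω) * ψ j (fun t => W t ω) := by
    funext ω
    have h := hsplit (fun j => ψ j (fun t => W t ω)) ω
    simpa only [ψ] using h
  clear_value φ ψ
  have hφN : ∀ j, Measurable fun ω => φ j (N ω) := fun j => (hφ j).comp hN
  have hψW : ∀ j, Measurable fun ω => ψ j (fun t => W t ω) := fun j => (hψ j).comp hWp
  have hmeas : ∀ j, Measurable fun ω => φ j (N ω) * ψ j (fun t => W t ω) := fun j =>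
    (hφN j).mul (hψW j)
  rw [h1]
  refine ⟨Measurable.tsum hmeas, ?_⟩
  have hg : Measurable fun ω => ENNReal.ofReal |(s : ℝ) - v (N ω)| :=
    (measurable_of_countable fun j : ℕ => ENNReal.ofReal |(s : ℝ) - v j|).comp hN
  rw [lintegral_tsum fun j => (hmeas j).aemeasurable, ← lintegral_const_mul _ hg,
    lintegral_congr (hsplit fun j => D * ENNReal.ofReal |(s : ℝ) - v j|), lintegral_tsum fun j => ((hφN j).mul_const _).aemeasurable]
  refine ENNReal.tsum_le_tsum fun j => ?_
  have h2 := lintegral_mul_eq_lintegral_mul_lintegral_of_indepFun ((hφ j).comp hN)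
    ((hψ j).comp hWp) (hind.comp (hφ j) (hψ j))
  simp only [Pi.mul_apply, Function.comp_apply] at h2
  rw [h2, lintegral_mul_const _ (hφN j), hψi]
  exact mul_le_mul_right (hinc s (v j)) _

/-- For a continuous process, the increment bound at deterministic times transfers to any random
time `σ ≤ s` independent of the process: discretise `σ` from below and apply Fatou's lemma. -/
lemma lintegral_increment_random_le [IsProbabilityMeasure P] {D : ℝ≥0∞} (hD : D ≠ ∞)
    (hWm : ∀ t, Measurable (W t)) (hWc : ∀ ω, Continuous fun t => W t ω)
    (hinc : ∀ s r, ∫⁻ ω, ‖W s ω - W r ω‖ₑ ^ 2 ∂P ≤ D * ENNReal.ofReal |(s : ℝ) - r|)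
    {σ : Ω → ℝ≥0} (hσ : Measurable σ) (hind : IndepFun σ (fun ω t => W t ω) P)
    {s : ℝ≥0} (hs : ∀ᵐ ω ∂P, σ ω ≤ s) :
    ∫⁻ ω, ‖W s ω - W (σ ω) ω‖ₑ ^ 2 ∂P ≤ D * ∫⁻ ω, ENNReal.ofReal ((s : ℝ) - σ ω) ∂P := by
  let N : ℕ → Ω → ℕ := fun k ω => ⌊σ ω * (k + 1)⌋₊
  let v : ℕ → ℕ → ℝ≥0 := fun k j => j / (k + 1)
  have hfl : ∀ k : ℕ, Measurable fun x : ℝ≥0 => ⌊x * (k + 1)⌋₊ := fun k =>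
    Nat.measurable_floor.comp (measurable_id.mul_const _)
  have hdisc := fun k => lintegral_increment_discrete_le hWm hinc ((hfl k).comp hσ)
    (hind.comp (hfl k) measurable_id) s (v k)
  have hlow : ∀ k ω, v k (N k ω) ≤ σ ω := fun k ω => by
    have : (0 : ℝ≥0) < k + 1 := by positivity
    exact (div_le_iff₀ this).2 (Nat.floor_le zero_le)
  have hup : ∀ k ω, (σ ω : ℝ) - 1 / (k + 1) ≤ v k (N k ω) := fun k ω => by
    have hk : (0 : ℝ) < k + 1 := by positivity
    have h1 : (σ ω : ℝ) * (k + 1) < N k ω + 1 := by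
      have := NNReal.coe_lt_coe.2 (Nat.lt_floor_add_one (σ ω * (k + 1)))
      simpa [N] using this
    have h2 : ((v k (N k ω) : ℝ≥0) : ℝ) = N k ω / (k + 1) := by simp [v]
    rw [h2, sub_le_iff_le_add, ← add_div, le_div_iff₀ hk]
    exact h1.le
  have hlim : ∀ ω, Tendsto (fun k => v k (N k ω)) atTop (𝓝 (σ ω)) := fun ω => by
    rw [← NNReal.tendsto_coe]
    refine tendsto_of_tendsto_of_tendsto_of_le_of_le ?_ tendsto_const_nhds
      (fun k => hup k ω) fun k => NNReal.coe_le_coe.2 (hlow k ω)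
    simpa using (tendsto_const_nhds (x := (σ ω : ℝ))).sub tendsto_one_div_add_atTop_nhds_zero_nat
  have hconv : ∀ ω, Tendsto (fun k => ‖W s ω - W (v k (N k ω)) ω‖ₑ ^ 2) atTop
      (𝓝 (‖W s ω - W (σ ω) ω‖ₑ ^ 2)) := fun ω => by
    have hc : Continuous fun t => ‖W s ω - W t ω‖ₑ ^ 2 :=
      (ENNReal.continuous_pow 2).comp (continuous_const.sub (hWc ω)).enorm
    exact (hc.tendsto (σ ω)).comp (hlim ω)
  have hbound : ∀ k : ℕ, ∫⁻ ω, ‖W s ω - W (v k (N k ω)) ω‖ₑ ^ 2 ∂P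
      ≤ D * (∫⁻ ω, ENNReal.ofReal ((s : ℝ) - σ ω) ∂P + ENNReal.ofReal (1 / (k + 1))) := by
    intro k
    refine (hdisc k).2.trans (mul_le_mul_right ?_ _)
    calc _ ≤ ∫⁻ ω, (ENNReal.ofReal ((s : ℝ) - σ ω) + ENNReal.ofReal (1 / (k + 1))) ∂P := by
          refine lintegral_mono_ae ?_
          filter_upwards [hs] with ω hω
          have h1 : (σ ω : ℝ) ≤ s := NNReal.coe_le_coe.2 hω
          have h2 : ((v k (N k ω) : ℝ≥0) : ℝ) ≤ σ ω := NNReal.coe_le_coe.2 (hlow k ω)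
          rw [← ENNReal.ofReal_add (by linarith) (by positivity)]
          refine ENNReal.ofReal_le_ofReal ?_
          have h3 := hup k ω
          change |(s : ℝ) - v k (N k ω)| ≤ _
          rw [abs_of_nonneg (by linarith)]
          linarith
      _ = _ := by rw [lintegral_add_right _ measurable_const]; simp
  calc ∫⁻ ω, ‖W s ω - W (σ ω) ω‖ₑ ^ 2 ∂P
      = ∫⁻ ω, liminf (fun k => ‖W s ω - W (v k (N k ω)) ω‖ₑ ^ 2) atTop ∂P :=
        lintegral_congr fun ω => (hconv ω).liminf_eq.symm
    _ ≤ liminf (fun k => ∫⁻ ω, ‖W s ω - W (v k (N k ω)) ω‖ₑ ^ 2 ∂P) atTop :=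
        lintegral_liminf_le fun k => (hdisc k).1
    _ ≤ liminf (fun k : ℕ => D * (∫⁻ ω, ENNReal.ofReal ((s : ℝ) - σ ω) ∂P
          + ENNReal.ofReal (1 / (k + 1)))) atTop :=
        liminf_le_liminf (.of_forall hbound)
    _ = _ := by
        refine Tendsto.liminf_eq ?_
        refine ENNReal.Tendsto.const_mul ?_ (.inr hD)
        have := ENNReal.tendsto_ofReal (tendsto_one_div_add_atTop_nhds_zero_nat (𝕜 := ℝ))
        simpa using tendsto_const_nhds.add this

end

/-! ### Expected error -/

section

variable {Ω : Type*} [MeasurableSpace Ω] {P : Measure Ω} {ν : Measure ℝ} {d m : ℕ}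
  {ξ : ℕ → Ω → ℝ} {W : ℝ≥0 → Ω → EuclideanSpace ℝ (Fin d)}

lemma aemeasurable_iSup_enorm {F : ℝ → Ω → EuclideanSpace ℝ (Fin d)}
    (hF : IsContinuousProcess F P) (T : ℝ) :
    AEMeasurable (fun ω => ⨆ t ∈ Icc (0 : ℝ) T, ‖F t ω‖ₑ) P := by
  obtain ⟨D, hDc, hDd⟩ := TopologicalSpace.exists_countable_dense (Icc (0 : ℝ) T)
  have hmeas : AEMeasurable (fun ω => ⨆ t ∈ D, ‖F (t : ℝ) ω‖ₑ) P :=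
    AEMeasurable.biSup D hDc fun t _ => (hF.aemeasurable t t.2.1).enorm
  refine hmeas.congr ?_
  filter_upwards [hF.continuousOn] with ω hω
  have hc : Continuous fun t : Icc (0 : ℝ) T => ‖F (t : ℝ) ω‖ₑ :=
    ((hω.mono Icc_subset_Ici_self).domRestrict).enorm
  refine le_antisymm (iSup₂_le fun t _ => le_iSup₂ (f := fun t _ => ‖F t ω‖ₑ) (t : ℝ) t.2) ?_
  have hcl : IsClosed {t : Icc (0 : ℝ) T | ‖F (t : ℝ) ω‖ₑ ≤ ⨆ t ∈ D, ‖F (t : ℝ) ω‖ₑ} :=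
    isClosed_le hc continuous_const
  have hall := hDd.closure_eq ▸ hcl.closure_subset_iff.2 fun t ht =>
    le_iSup₂ (f := fun (t : Icc (0 : ℝ) T) _ => ‖F (t : ℝ) ω‖ₑ) t ht
  refine iSup₂_le fun t ht => ?_
  have h := hall (mem_univ ⟨t, ht⟩)
  rwa [mem_ofPred_eq] at h

lemma measurable_comp_toNNReal (hWm : ∀ t, Measurable (W t)) (hWc : ∀ ω, Continuous fun t => W t ω)
    {α : Type*} [MeasurableSpace α] {σ : α → ℝ} {g : α → Ω} (hσ : Measurable σ)
    (hg : Measurable g) : Measurable fun a => W (σ a).toNNReal (g a) :=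
  (measurable_uncurry_of_continuous_of_measurable (u := W) hWc hWm).comp
    (hσ.real_toNNReal.prodMk hg)

lemma lintegral_integrated_increment_le [IsProbabilityMeasure P] (hξ : IsIID ξ ν P)
    (hν : IsSamplingLaw ν) {D : ℝ≥0∞} (hD : D ≠ ∞)
    (hWm : ∀ t, Measurable (W t)) (hWc : ∀ ω, Continuous fun t => W t ω)
    (hinc : ∀ s r, ∫⁻ ω, ‖W s ω - W r ω‖ₑ ^ 2 ∂P ≤ D * ENNReal.ofReal |(s : ℝ) - r|)
    (hind : IndepFun (fun ω i => ξ i ω) (fun ω t => W t ω) P)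
    {n : ℕ} (hn : 0 < n) {T : ℝ} (hT : 0 ≤ T) :
    ∫⁻ ω, (∫⁻ s in Icc 0 T, ‖W s.toNNReal ω - W (supSample ξ n s ω).toNNReal ω‖ₑ ^ 2) ∂P
      ≤ D * (ENNReal.ofReal ((n : ℝ)⁻¹) * ageConst ν T) := by
  have hswap : Measurable fun z : Ω × ℝ => supSample ξ n z.2 z.1 :=
    measurable_supSample hξ.measurable n measurable_snd measurable_fst
  have hm1 : Measurable fun z : Ω × ℝ =>
      ‖W z.2.toNNReal z.1 - W (supSample ξ n z.2 z.1).toNNReal z.1‖ₑ ^ 2 :=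
    ((measurable_comp_toNNReal hWm hWc measurable_snd measurable_fst).sub
      (measurable_comp_toNNReal hWm hWc hswap measurable_fst)).enorm.pow_const 2
  have hm2 : Measurable fun z : Ω × ℝ => ENNReal.ofReal (z.2 - supSample ξ n z.2 z.1) :=
    (measurable_snd.sub hswap).ennreal_ofReal
  rw [lintegral_lintegral_swap hm1.aemeasurable]
  calc ∫⁻ s in Icc 0 T, (∫⁻ ω, ‖W s.toNNReal ω - W (supSample ξ n s ω).toNNReal ω‖ₑ ^ 2 ∂P)
      ≤ ∫⁻ s in Icc 0 T, D * ∫⁻ ω, ENNReal.ofReal (s - supSample ξ n s ω) ∂P := by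
        refine setLIntegral_mono' measurableSet_Icc fun s hs => ?_
        -- `supSample` at a fixed time is a measurable functional of the sequence `ξ`.
        have hfun : Measurable (supSample (fun i (y : ℕ → ℝ) => y i) n s) :=
          measurable_supSample (fun i => measurable_pi_apply i) n measurable_const measurable_id
        have hi : IndepFun (fun ω => (supSample ξ n s ω).toNNReal) (fun ω t => W t ω) P :=
          hind.comp hfun.real_toNNReal measurable_id
        have hae : ∀ᵐ ω ∂P, supSample ξ n s ω ∈ Icc 0 s := by
          filter_upwards [hξ.ae_pos hν, hξ.ae_bddAbove hν hn] with ω h1 h2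
          rw [supSample_eq_lastSample hs.1 h1 (h2 s)]
          exact lastSample_mem hs.1 h1 (h2 s)
        refine (lintegral_increment_random_le hD hWm hWc hinc
          (measurable_supSample hξ.measurable n measurable_const measurable_id').real_toNNReal hi (s := s.toNNReal) ?_).trans ?_
        · filter_upwards [hae] with ω hω using Real.toNNReal_le_toNNReal hω.2
        · refine mul_le_mul_right (lintegral_mono_ae ?_) _
          filter_upwards [hae] with ω hω
          rw [Real.coe_toNNReal _ hs.1, Real.coe_toNNReal _ hω.1]
    _ = D * ∫⁻ ω, (∫⁻ s in Icc 0 T, ENNReal.ofReal (s - supSample ξ n s ω)) ∂P := by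
        rw [lintegral_const_mul' _ _ hD, ← lintegral_lintegral_swap
          (f := fun ω s => ENNReal.ofReal (s - supSample ξ n s ω)) hm2.aemeasurable]
    _ ≤ _ := mul_le_mul_right (hξ.lintegral_age_le hν hn hT) _

lemma lintegral_integrated_sq_le [IsProbabilityMeasure P] {D : ℝ≥0∞}
    (hWm : ∀ t, Measurable (W t)) (hWc : ∀ ω, Continuous fun t => W t ω)
    (hev : ∀ s, ∫⁻ ω, ‖W s ω‖ₑ ^ 2 ∂P ≤ D * ENNReal.ofReal s) {T : ℝ} (hT : 0 ≤ T) :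
    ∫⁻ ω, (∫⁻ s in Icc 0 T, ‖W s.toNNReal ω‖ₑ ^ 2) ∂P ≤ D * ENNReal.ofReal (T ^ 2) := by
  have hm : Measurable fun z : Ω × ℝ => ‖W z.2.toNNReal z.1‖ₑ ^ 2 :=
    (measurable_comp_toNNReal hWm hWc measurable_snd measurable_fst).enorm.pow_const 2
  rw [lintegral_lintegral_swap hm.aemeasurable]
  calc ∫⁻ s in Icc 0 T, (∫⁻ ω, ‖W s.toNNReal ω‖ₑ ^ 2 ∂P)
      ≤ ∫⁻ _ in Icc 0 T, D * ENNReal.ofReal T :=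
        setLIntegral_mono' measurableSet_Icc fun s hs => (hev _).trans <| by
          rw [Real.coe_toNNReal _ hs.1]
          gcongr
          exact hs.2
    _ = D * ENNReal.ofReal (T ^ 2) := by
        rw [setLIntegral_const, Real.volume_Icc, sub_zero, mul_assoc, ← ENNReal.ofReal_mul hT, sq]

lemma ofReal_intervalIntegral_le {T : ℝ} (hT : 0 ≤ T) (f : ℝ → ℝ) :
    ENNReal.ofReal (∫ s in (0 : ℝ)..T, f s) ≤ ∫⁻ s in Icc 0 T, ‖f s‖ₑ := by
  rw [intervalIntegral.integral_of_le hT, ← integral_Icc_eq_integral_Ioc]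
  exact (Real.ofReal_le_enorm _).trans (enorm_integral_le_lintegral_enorm _)

lemma act_sub {d : ℕ} (A G : Matrix (Fin d) (Fin d) ℝ) (v : EuclideanSpace ℝ (Fin d)) :
    act (A - G) v = act A v - act G v := by
  simp [act, map_sub]

lemma meanAge_nonneg (hν : IsSamplingLaw ν) : 0 ≤ meanAge ν :=
  div_nonneg (integral_nonneg fun _ => sq_nonneg _)
    (mul_nonneg zero_le_two (integral_nonneg_of_ae (hν.pos.mono fun _ hx => hx.le)))

/-- Pathwise bound for the sampled system with an everywhere continuous version `W'` of the noise,
with all time integrals taken in `[0, ∞]`. -/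
lemma exists_ae_supError_le (A : Matrix (Fin d) (Fin d) ℝ) (B : Matrix (Fin d) (Fin m) ℝ)
    (K : Matrix (Fin m) (Fin d) ℝ) (R : ℝ) {T : ℝ} (hT : 0 < T) :
    ∃ C : ℝ, 0 < C ∧ ∀ {Ω : Type*} [MeasurableSpace Ω] {P : Measure Ω} [IsProbabilityMeasure P]
      {ν : Measure ℝ} {ξ : ℕ → Ω → ℝ} {W W' : ℝ≥0 → Ω → EuclideanSpace ℝ (Fin d)}
      {x₀ : EuclideanSpace ℝ (Fin d)} {x : ℝ → EuclideanSpace ℝ (Fin d)}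
      {X Z : ℝ → Ω → EuclideanSpace ℝ (Fin d)} {c M ε q : ℝ} {n : ℕ},
      IsSamplingLaw ν → IsIID ξ ν P → (∀ ω, Continuous fun t => W' t ω) →
      (∀ᵐ ω ∂P, ∀ t, W' t ω = W t ω) → ‖x₀‖ ≤ R → IsIdealSolution A B K x₀ x →
      0 ≤ c * M → 0 < q → 0 < n → 0 ≤ ε → ε ≤ 1 → IsSampledSolution A B K x₀ ξ W P ε n X →
      IsFluctuationLimit A B K x W P c M Z →
      ∀ᵐ ω ∂P, supError X x Z ε T ω ≤ ENNReal.ofReal C *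
        (ENNReal.ofReal q * ((∫⁻ s in Icc 0 T, ENNReal.ofReal (s - supSample ξ n s ω))
            + ∫⁻ s in Icc 0 T, ‖W' s.toNNReal ω - W' (supSample ξ n s ω).toNNReal ω‖ₑ ^ 2)
          + ENNReal.ofReal q⁻¹ * (1 + (∫⁻ s in Icc 0 T, ‖W' s.toNNReal ω‖ₑ ^ 2)
            + ∫⁻ s in Icc 0 T, ‖W' s.toNNReal ω - W' (supSample ξ n s ω).toNNReal ω‖ₑ ^ 2)
          + ENNReal.ofReal (ε * (c * M))) := by
  let A' := Matrix.toEuclideanCLM (n := Fin d) (𝕜 := ℝ) A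
  let G' := Matrix.toEuclideanCLM (n := Fin d) (𝕜 := ℝ) (B * K)
  obtain ⟨C, hC, hmain⟩ := exists_pathwise_error_bound (E := EuclideanSpace ℝ (Fin d))
    (β := ‖A'‖ + ‖G'‖) (by positivity) (le_max_right R 0) hT
  refine ⟨C, hC, ?_⟩
  intro Ω _ P _ ν ξ W W' x₀ x X Z c M ε q n hν hξ hWc hWW hx₀ hx hcM hq hn hε0 hε1 hX hZ
  filter_upwards [hξ.ae_pos hν, hξ.ae_bddAbove hν hn, hWW, hX.continuousOn, hX.eq,
    hZ.continuousOn, hZ.eq] with ω hpos hfin hWω hXc hXe hZc hZe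
  have hext : ∀ {f : ℝ → EuclideanSpace ℝ (Fin d)}, ContinuousOn f (Ici 0) →
      Continuous fun t => f (max t 0) := fun hf =>
    hf.comp_continuous (by fun_prop) fun t => le_max_right t 0
  have hmem : ∀ s, 0 ≤ s → supSample ξ n s ω ∈ Icc 0 s := fun s hs => by
    rw [supSample_eq_lastSample hs hpos (hfin s)]
    exact lastSample_mem hs hpos (hfin s)
  have hmax : ∀ s ∈ Icc 0 T, max s 0 = s := fun s hs => max_eq_left hs.1
  have hbd := hmain A' G' x₀ (fun t => X (max t 0) ω) (fun t => x (max t 0))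
    (fun t => Z (max t 0) ω) (fun t => W' t.toNNReal ω) (fun s => supSample ξ n s ω) ε (c * M) q
    le_rfl (hx₀.trans (le_max_left _ _)) (hext hXc) (hext hx.continuousOn) (hext hZc)
    ((hWc ω).comp continuous_real_toNNReal)
    (measurable_supSample hξ.measurable n measurable_id measurable_const)
    (fun s hs => hmem s hs.1) hε0 hε1 hcM hq
    (fun t ht => by
      simp only [hmax t ht]
      have h := hXe t.toNNReal
      rw [Real.coe_toNNReal t ht.1] at h
      rw [h, hWω]
      congr 2
      refine intervalIntegral.integral_congr fun s hs => ?_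
      rw [uIcc_of_le ht.1] at hs
      simp only [max_eq_left hs.1,
        supSample_eq_lastSample hs.1 hpos (hfin s)]
      rw [max_eq_left (lastSample_mem hs.1 hpos (hfin s)).1]
      rfl)
    (fun t ht => by
      simp only [hmax t ht]
      rw [hx.eq t ht.1]
      congr 1
      refine intervalIntegral.integral_congr fun s hs => ?_
      rw [uIcc_of_le ht.1] at hs
      simp only [max_eq_left hs.1, act_sub]
      rfl)
    (fun t ht => by
      simp only [hmax t ht]
      have h := hZe t.toNNReal
      rw [Real.coe_toNNReal t ht.1] at h
      rw [h, hWω]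
      have hc : ∀ f : ℝ → EuclideanSpace ℝ (Fin d),
          ∫ s in (0 : ℝ)..t, act (A - B * K) (f s)
            = ∫ s in (0 : ℝ)..t, (A' (f (max s 0)) - G' (f (max s 0))) := fun f =>
        intervalIntegral.integral_congr fun s hs => by
          rw [uIcc_of_le ht.1] at hs
          simp only [max_eq_left hs.1, act_sub]
          rfl
      rw [hc fun s => Z s ω, hc x]
      rfl)
  set α := ∫ s in (0 : ℝ)..T, (s - supSample ξ n s ω)
  set Q := ∫ s in (0 : ℝ)..T, ‖W' s.toNNReal ω - W' (supSample ξ n s ω).toNNReal ω‖ ^ 2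
  set S := ∫ s in (0 : ℝ)..T, ‖W' s.toNNReal ω‖ ^ 2
  have hα0 : 0 ≤ α := intervalIntegral.integral_nonneg hT.le fun s hs =>
    sub_nonneg.2 (hmem s hs.1).2
  have hQ0 : 0 ≤ Q := intervalIntegral.integral_nonneg hT.le fun _ _ => sq_nonneg _
  have hS0 : 0 ≤ S := intervalIntegral.integral_nonneg hT.le fun _ _ => sq_nonneg _
  have hα : ENNReal.ofReal α ≤ ∫⁻ s in Icc 0 T, ENNReal.ofReal (s - supSample ξ n s ω) := by
    refine (ofReal_intervalIntegral_le hT.le _).trans (le_of_eq ?_)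
    exact setLIntegral_congr_fun measurableSet_Icc fun s hs =>
      Real.enorm_of_nonneg (sub_nonneg.2 (hmem s hs.1).2)
  have hQ : ENNReal.ofReal Q
      ≤ ∫⁻ s in Icc 0 T, ‖W' s.toNNReal ω - W' (supSample ξ n s ω).toNNReal ω‖ₑ ^ 2 := by
    refine (ofReal_intervalIntegral_le hT.le _).trans (le_of_eq ?_)
    simp only [enorm_pow, enorm_norm]
  have hS : ENNReal.ofReal S ≤ ∫⁻ s in Icc 0 T, ‖W' s.toNNReal ω‖ₑ ^ 2 := by
    refine (ofReal_intervalIntegral_le hT.le _).trans (le_of_eq ?_)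
    simp only [enorm_pow, enorm_norm]
  refine iSup₂_le fun t ht => ?_
  have h := hbd t ht
  simp only [hmax t ht] at h
  rw [← ofReal_norm]
  refine (ENNReal.ofReal_le_ofReal h).trans ?_
  rw [ENNReal.ofReal_mul hC.le, ENNReal.ofReal_add (by positivity) (by positivity),
    ENNReal.ofReal_add (by positivity) (by positivity), ENNReal.ofReal_mul hq.le,
    ENNReal.ofReal_mul (by positivity), ENNReal.ofReal_add hα0 hQ0,
    ENNReal.ofReal_add (by positivity) hQ0, ENNReal.ofReal_add one_pos.le hS0, ENNReal.ofReal_one]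
  gcongr

/-- The expected error is of order `n ^ (-1/2) + M * ϰ`. The drift correction in `Z`, of size
`ε * c * M`, is at most `M / n + M * ϰ`. -/
lemma exists_lintegral_supError_le (A : Matrix (Fin d) (Fin d) ℝ) (B : Matrix (Fin d) (Fin m) ℝ)
    (K : Matrix (Fin m) (Fin d) ℝ) (hν : IsSamplingLaw ν) (R : ℝ) {T : ℝ} (hT : 0 < T) :
    ∃ C : ℝ, 0 < C ∧ ∀ {Ω : Type*} [MeasurableSpace Ω] {P : Measure Ω} [IsProbabilityMeasure P]
      {ξ : ℕ → Ω → ℝ} {W : ℝ≥0 → Ω → EuclideanSpace ℝ (Fin d)}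
      {x₀ : EuclideanSpace ℝ (Fin d)} {x : ℝ → EuclideanSpace ℝ (Fin d)}
      {X Z : ℝ → Ω → EuclideanSpace ℝ (Fin d)} {c ε : ℝ} {n : ℕ},
      IsIID ξ ν P → IsBrownianMotion W P →
      IndepFun (fun ω i => ξ i ω) (fun ω t => W t ω) P → ‖x₀‖ ≤ R → IsIdealSolution A B K x₀ x →
      0 ≤ c → 0 < n → 0 < ε → ε ≤ 1 → IsSampledSolution A B K x₀ ξ W P ε n X →
      IsFluctuationLimit A B K x W P c (meanAge ν) Z →
      ∫⁻ ω, supError X x Z ε T ω ∂P ≤ ENNReal.ofReal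
        ((meanAge ν * kappa c ε n + (n : ℝ) ^ (-(1 / 2) : ℝ)) * C) := by
  obtain ⟨C, hC, hpath⟩ := exists_ae_supError_le A B K R hT
  have hM := meanAge_nonneg hν
  set M := meanAge ν
  set a := (ageConst ν T).toReal
  have ha0 : 0 ≤ a := ENNReal.toReal_nonneg
  have hage : ageConst ν T = ENNReal.ofReal a :=
    (ENNReal.ofReal_toReal (hν.ageConst_ne_top T)).symm
  refine ⟨C * (1 + (1 + 2 * d) * a + d * T ^ 2 + M), by positivity, ?_⟩
  intro Ω _ P _ ξ W x₀ x X Z c ε n hξ hW hind hx₀ hx hc hn hε0 hε1 hX hZ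
  have hn1 : (1 : ℝ) ≤ n := by exact_mod_cast hn
  have hn0 : (0 : ℝ) < n := by linarith
  obtain ⟨W', hWm, hWc, hWW⟩ := hW.exists_continuous_version
  have hinc : ∀ s r, ∫⁻ ω, ‖W' s ω - W' r ω‖ₑ ^ 2 ∂P ≤ (d : ℝ≥0∞) * ENNReal.ofReal |(s : ℝ) - r| :=
    fun s r => by
      rw [← hW.lintegral_increment s r]
      refine lintegral_mono_ae ?_
      filter_upwards [hWW] with ω hω
      rw [hω, hω]
  have hev : ∀ s, ∫⁻ ω, ‖W' s ω‖ₑ ^ 2 ∂P ≤ (d : ℝ≥0∞) * ENNReal.ofReal s := fun s => by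
    rw [← hW.lintegral_eval s]
    refine lintegral_mono_ae ?_
    filter_upwards [hWW] with ω hω
    rw [hω]
  have hind' : IndepFun (fun ω i => ξ i ω) (fun ω t => W' t ω) P :=
    hind.congr .rfl (by filter_upwards [hWW] with ω hω using funext fun t => (hω t).symm)
  set q := √(n : ℝ)
  have hq : 0 < q := Real.sqrt_pos.2 hn0
  have hq2 : q * (n : ℝ)⁻¹ = q⁻¹ := by
    have : q * q = n := Real.mul_self_sqrt hn0.le
    rw [← this]; field_simp
  have hqr : (n : ℝ) ^ (-(1 / 2) : ℝ) = q⁻¹ := by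
    rw [Real.rpow_neg hn0.le, ← Real.sqrt_eq_rpow]
  have hninv : (n : ℝ)⁻¹ ≤ 1 := inv_le_one_of_one_le₀ hn1
  have hnq : (n : ℝ)⁻¹ ≤ q⁻¹ := by
    rw [← hq2]
    exact le_mul_of_one_le_left (by positivity) (Real.one_le_sqrt.2 hn1)
  have e1 := hξ.lintegral_age_le hν hn hT.le
  have e2 := lintegral_integrated_increment_le hξ hν (ENNReal.natCast_ne_top d) hWm hWc hinc hind'
    hn hT.le
  have e3 := lintegral_integrated_sq_le hWm hWc hev hT.le
  have hsw : Measurable fun z : Ω × ℝ => supSample ξ n z.2 z.1 :=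
    measurable_supSample hξ.measurable n measurable_snd measurable_fst
  have m2 : Measurable fun ω => ∫⁻ s in Icc 0 T,
      ‖W' s.toNNReal ω - W' (supSample ξ n s ω).toNNReal ω‖ₑ ^ 2 :=
    Measurable.lintegral_prod_right' (f := fun z : Ω × ℝ =>
      ‖W' z.2.toNNReal z.1 - W' (supSample ξ n z.2 z.1).toNNReal z.1‖ₑ ^ 2)
      (((measurable_comp_toNNReal hWm hWc measurable_snd measurable_fst).sub
        (measurable_comp_toNNReal hWm hWc hsw measurable_fst)).enorm.pow_const 2)
  have m3 : Measurable fun ω => ∫⁻ s in Icc 0 T, ‖W' s.toNNReal ω‖ₑ ^ 2 :=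
    Measurable.lintegral_prod_right' (f := fun z : Ω × ℝ => ‖W' z.2.toNNReal z.1‖ₑ ^ 2)
      ((measurable_comp_toNNReal hWm hWc measurable_snd measurable_fst).enorm.pow_const 2)
  have m4 : Measurable fun ω => 1 + ∫⁻ s in Icc 0 T, ‖W' s.toNNReal ω‖ₑ ^ 2 :=
    measurable_const.add m3
  have m5 : Measurable fun ω => ENNReal.ofReal q⁻¹ *
      (1 + (∫⁻ s in Icc 0 T, ‖W' s.toNNReal ω‖ₑ ^ 2)
        + ∫⁻ s in Icc 0 T, ‖W' s.toNNReal ω - W' (supSample ξ n s ω).toNNReal ω‖ₑ ^ 2) :=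
    (m4.add m2).const_mul _
  refine (lintegral_mono_ae (hpath (q := q) hν hξ hWc hWW hx₀ hx (mul_nonneg hc hM) hq hn hε0.le
    hε1 hX hZ)).trans ?_
  rw [lintegral_const_mul' _ _ ENNReal.ofReal_ne_top, lintegral_add_right _ measurable_const,
    lintegral_add_right _ m5,
    lintegral_const_mul' _ _ ENNReal.ofReal_ne_top, lintegral_const_mul' _ _ ENNReal.ofReal_ne_top,
    lintegral_add_right _ m2, lintegral_add_right _ m2, lintegral_add_right _ m3,
    lintegral_const, lintegral_const, measure_univ, mul_one, mul_one]
  have hdr : (d : ℝ≥0∞) = ENNReal.ofReal d := (ENNReal.ofReal_natCast d).symm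
  rw [hage, ← ENNReal.ofReal_mul (by positivity)] at e1 e2
  rw [hdr, ← ENNReal.ofReal_mul (by positivity)] at e2 e3
  refine (mul_le_mul_right (add_le_add_left (add_le_add (mul_le_mul_right (add_le_add e1 e2) _)
    (mul_le_mul_right (add_le_add (add_le_add_right e3 1) e2) _)) _) _).trans ?_
  rw [← ENNReal.ofReal_one, ← ENNReal.ofReal_add (by positivity) (by positivity),
    ← ENNReal.ofReal_add (by positivity) (by positivity),
    ← ENNReal.ofReal_add (by positivity) (by positivity),
    ← ENNReal.ofReal_mul (by positivity), ← ENNReal.ofReal_mul (by positivity),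
    ← ENNReal.ofReal_add (by positivity) (by positivity),
    ← ENNReal.ofReal_add (by positivity) (by positivity), ← ENNReal.ofReal_mul (by positivity)]
  refine ENNReal.ofReal_le_ofReal ?_
  rw [hqr]
  have hκ0 : 0 ≤ kappa c ε n := abs_nonneg _
  have hκ : ε * c ≤ (n : ℝ)⁻¹ + kappa c ε n := by
    have h1 : c - 1 / (n * ε) ≤ kappa c ε n := by
      rw [kappa, abs_sub_comm]; exact le_abs_self _
    have h2 : ε * (c - 1 / (n * ε)) ≤ ε * kappa c ε n := by gcongr
    have h3 : ε * kappa c ε n ≤ kappa c ε n := mul_le_of_le_one_left hκ0 hε1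
    have h4 : ε * (c - 1 / (n * ε)) = ε * c - (n : ℝ)⁻¹ := by field_simp
    linarith
  have hεcM : ε * (c * M) ≤ q⁻¹ * M + M * kappa c ε n := by
    have h1 := mul_le_mul_of_nonneg_right (hκ.trans (add_le_add_left hnq _)) hM
    linarith
  set κ := kappa c ε n
  have hq0 : 0 < q⁻¹ := inv_pos.2 hq
  have t1 : q * ((n : ℝ)⁻¹ * a + d * ((n : ℝ)⁻¹ * a)) = q⁻¹ * ((1 + d) * a) := by
    rw [← hq2]; ring
  have t2 : q⁻¹ * (1 + d * T ^ 2 + d * ((n : ℝ)⁻¹ * a)) ≤ q⁻¹ * (1 + d * T ^ 2 + d * (1 * a)) := by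
    gcongr
  rw [t1, mul_comm _ (C * _), mul_assoc]
  refine mul_le_mul_of_nonneg_left ?_ hC.le
  have t3 : 0 ≤ M * κ * ((1 + 2 * d) * a + d * T ^ 2 + M) := by positivity
  linarith

end

end SampledControl

/-- The constant `C T` depends on `A`, `B`, `K`, the law `ν` of `ξ₁`, the bound `R` on the initial
datum and on `T` only. -/
theorem theorem2p2 {d m : ℕ} (A : Matrix (Fin d) (Fin d) ℝ) (B : Matrix (Fin d) (Fin m) ℝ)
    (K : Matrix (Fin m) (Fin d) ℝ) (hA : IsUnit A) (hcomm : Commute A (B * K))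
    (ν : Measure ℝ) (hν : SampledControl.IsSamplingLaw ν) (R : ℝ) :
    ∃ C : ℝ → ℝ, (∀ T, 0 < C T) ∧
      ∀ {Ω : Type*} [MeasurableSpace Ω] (P : Measure Ω) [IsProbabilityMeasure P]
        (ξ : ℕ → Ω → ℝ) (W : ℝ≥0 → Ω → EuclideanSpace ℝ (Fin d))
        (x₀ : EuclideanSpace ℝ (Fin d)) (x : ℝ → EuclideanSpace ℝ (Fin d)) (c : ℝ) (n : ℝ → ℕ),
        SampledControl.IsIID ξ ν P →
        SampledControl.IsBrownianMotion W P →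
        IndepFun (fun ω i => ξ i ω) (fun ω t => W t ω) P →
        ‖x₀‖ ≤ R →
        SampledControl.IsIdealSolution A B K x₀ x →
        SampledControl.IsScaling c n →
        ∃ ε₀ ∈ Ioo (0 : ℝ) 1, ∀ T : ℝ, 0 < T → ∀ ε ∈ Ioo 0 ε₀,
          ∀ X Z : ℝ → Ω → EuclideanSpace ℝ (Fin d),
            SampledControl.IsSampledSolution A B K x₀ ξ W P ε (n ε) X →
            SampledControl.IsFluctuationLimit A B K x W P c (SampledControl.meanAge ν) Z →
            AEMeasurable (SampledControl.supError X x Z ε T) P ∧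
            ∫⁻ ω, SampledControl.supError X x Z ε T ω ∂P ≤ ENNReal.ofReal
              ((c * ((n ε : ℝ) ^ (-(1 / 2) : ℝ) * ((n ε : ℝ)⁻¹ + ε) + (n ε : ℝ) ^ (-(1 / 4) : ℝ))
                + SampledControl.meanAge ν * SampledControl.kappa c ε (n ε)
                + (n ε : ℝ) ^ (-(1 / 2) : ℝ)) * C T) := by
  open SampledControl in
  have hC : ∀ T : ℝ, ∃ C : ℝ, 0 < C ∧ (0 < T → ∀ {Ω : Type _} [MeasurableSpace Ω] {P : Measure Ω}
      [IsProbabilityMeasure P] {ξ : ℕ → Ω → ℝ} {W : ℝ≥0 → Ω → EuclideanSpace ℝ (Fin d)}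
      {x₀ : EuclideanSpace ℝ (Fin d)} {x : ℝ → EuclideanSpace ℝ (Fin d)}
      {X Z : ℝ → Ω → EuclideanSpace ℝ (Fin d)} {c ε : ℝ} {n : ℕ},
      IsIID ξ ν P → IsBrownianMotion W P →
      IndepFun (fun ω i => ξ i ω) (fun ω t => W t ω) P → ‖x₀‖ ≤ R → IsIdealSolution A B K x₀ x →
      0 ≤ c → 0 < n → 0 < ε → ε ≤ 1 → IsSampledSolution A B K x₀ ξ W P ε n X →
      IsFluctuationLimit A B K x W P c (meanAge ν) Z →
      ∫⁻ ω, supError X x Z ε T ω ∂P ≤ ENNReal.ofReal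
        ((meanAge ν * kappa c ε n + (n : ℝ) ^ (-(1 / 2) : ℝ)) * C)) := fun T => by
    by_cases hT : 0 < T
    · obtain ⟨C, hC, h⟩ := exists_lintegral_supError_le A B K hν R hT
      exact ⟨C, hC, fun _ => h⟩
    · exact ⟨1, one_pos, fun h => absurd h hT⟩
  choose C hC0 hCb using hC
  refine ⟨C, hC0, ?_⟩
  intro Ω _ P _ ξ W x₀ x c n hξ hW hind hx₀ hx hsc
  have hn : ∀ᶠ ε in 𝓝[>] (0 : ℝ), 0 < n ε := hsc.tendsto_atTop.eventually (eventually_gt_atTop 0)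
  obtain ⟨u, hu, hun⟩ := mem_nhdsGT_iff_exists_Ioo_subset.1 hn
  refine ⟨min u (1 / 2), ⟨lt_min hu (by norm_num), (min_le_right _ _).trans_lt (by norm_num)⟩, ?_⟩
  intro T hT ε hε X Z hX hZ
  have hε1 : ε ≤ 1 := (hε.2.le.trans (min_le_right _ _)).trans (by norm_num)
  have hn0 : 0 < n ε := hun ⟨hε.1, hε.2.trans_le (min_le_left _ _)⟩
  refine ⟨SampledControl.aemeasurable_iSup_enorm (F := fun t ω => X t ω - x t - ε • Z t ω)
    ⟨fun t ht => ((hX.aemeasurable t ht).sub aemeasurable_const).sub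
      ((hZ.aemeasurable t ht).const_smul ε), ?_⟩ T, ?_⟩
  · filter_upwards [hX.continuousOn, hZ.continuousOn] with ω h1 h2
    exact (h1.sub hx.continuousOn).sub (h2.const_smul ε)
  · refine (hCb T hT hξ hW hind hx₀ hx hsc.nonneg hn0 hε.1 hε1 hX hZ).trans
      (ENNReal.ofReal_le_ofReal (mul_le_mul_of_nonneg_right ?_ (hC0 T).le))
    have h0 : 0 ≤ c * ((n ε : ℝ) ^ (-(1 / 2) : ℝ) * ((n ε : ℝ)⁻¹ + ε)
        + (n ε : ℝ) ^ (-(1 / 4) : ℝ)) := by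
      have := hsc.nonneg
      have := hε.1
      positivity
    linarith
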